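/- Let $\triangle=\{z\in\mathbb C:|z|<1\}$. Let $\mathcal Z$ be the Zygmund space of all analytic functions $f$ on $\triangle$ that extend continuously to $\overline{\triangle}$ and satisfy $\sup_{|z|<1}(1-|z|^2)|f''(z)|<\infty$, with norm $$\|f\|_{\mathcal Z}=|f(0)|+|f'(0)|+\sup_{|z|<1}(1-|z|^2)|f''(z)| ,$$ let $\mathcal Z_0=\{f\in\mathcal Z:\lim_{|z|\to1^-}(1-|z|^2)|f''(z)|=0\}$ and $\mathcal Z_0^{(0,1)}=\{f\in\mathcal Z_0: f(0)=f'(0)=0\}$. A family $\{T_t\}_{t\in\mathbb R}$ of operators on $\mathcal Z_0^{(0,1)}$ is a strongly continuous one-parameter group if $T_0=\mathrm{Id}$, $T_{s+t}=T_sT_t$ for all $s,t\in\mathbb R$, and $\lim_{t\to0}\|T_tf-f\|_{\mathcal Z}=0$ for every $f\in\mathcal Z_0^{(0,1)}$. A continuous one-parameter group of disc automorphisms is a family $\{\sigma_t\}_{t\in\mathbb R}$ of holomorphic bijections of $\triangle$ onto itself with $\sigma_0=\mathrm{id}$, $\sigma_{s+t}=\sigma_s\circ\sigma_t$ for all $s,t\in\mathbb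 R$, and $t\mapsto\sigma_t(z)$ continuous on $\mathbb R$ for every $z\in\triangle$. **Proposition.** Let $\{T_t\}_{t\in\mathbb R}$ be a family of surjective (complex-)linear isometries of $\mathcal Z_0^{(0,1)}$. Then $\{T_t\}_{t\in\mathbb R}$ is a strongly continuous one-parameter group if and only if there exist a continuous one-parameter group of disc automorphisms $\{\sigma_t\}_{t\in\mathbb R}$ and a complex number $\alpha$ such that $$T_tf(z)=e^{i\alpha t}\int_0^z\bigl[f'(\sigma_t(\xi))-f'(\sigma_t(0))\bigr]\,d\xi\qquad\text{for all }t\in\mathbb R,\ f\in\mathcal Z_0^{(0,1)},\ z\in\triangle .$$ Moreover, in every such representation $\alpha$ is real and $\sigma_t\to\mathrm{id}$ uniformly on $\triangle$ as $t\to0$. -/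

import Mathlib

/-- The open unit disc in `ℂ`. -/
abbrev unitDisc : Set ℂ := Metric.ball (0 : ℂ) 1

/-- The membership condition of the Zygmund space.  A function on the open unit disc is represented
by its extension by zero to `ℂ`, so that two such functions are equal exactly when they agree on
the disc. -/
structure IsZygmund (f : ℂ → ℂ) : Prop where
  analytic : DifferentiableOn ℂ f unitDisc
  eq_zero_off : ∀ z, z ∉ unitDisc → f z = 0
  /-- `f` extends continuously to the boundary of the disc. -/
  extends_closure : ∃ g : ℂ → ℂ, ContinuousOn g (Metric.closedBall 0 1) ∧ Set.EqOn g f unitDisc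
  bounded : BddAbove (Set.range fun z : unitDisc => (1 - ‖(z : ℂ)‖ ^ 2) * ‖iteratedDeriv 2 f z‖)

theorem IsZygmund.contDiffAt {f : ℂ → ℂ} (hf : IsZygmund f) {z : ℂ} (hz : z ∈ unitDisc) :
    ContDiffAt ℂ (2 : ℕ) f z :=
  (hf.analytic.analyticAt (Metric.isOpen_ball.mem_nhds hz)).contDiffAt

theorem one_sub_norm_sq_nonneg (z : unitDisc) : 0 ≤ 1 - ‖(z : ℂ)‖ ^ 2 := by
  have h := z.2
  rw [Metric.mem_ball, dist_zero_right] at h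
  nlinarith [norm_nonneg (z : ℂ)]

theorem IsZygmund.iteratedDeriv_add {f g : ℂ → ℂ} (hf : IsZygmund f) (hg : IsZygmund g)
    {z : ℂ} (hz : z ∈ unitDisc) :
    iteratedDeriv 2 (f + g) z = iteratedDeriv 2 f z + iteratedDeriv 2 g z :=
  _root_.iteratedDeriv_add (hf.contDiffAt hz) (hg.contDiffAt hz)

theorem IsZygmund.iteratedDeriv_smul {f : ℂ → ℂ} (hf : IsZygmund f) (c : ℂ)
    {z : ℂ} (hz : z ∈ unitDisc) :
    iteratedDeriv 2 (c • f) z = c * iteratedDeriv 2 f z :=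
  iteratedDeriv_const_smul (hf.contDiffAt hz) c

theorem IsZygmund.add_le {f g : ℂ → ℂ} (hf : IsZygmund f) (hg : IsZygmund g) (z : unitDisc) :
    (1 - ‖(z : ℂ)‖ ^ 2) * ‖iteratedDeriv 2 (f + g) z‖ ≤
      (1 - ‖(z : ℂ)‖ ^ 2) * ‖iteratedDeriv 2 f z‖ +
        (1 - ‖(z : ℂ)‖ ^ 2) * ‖iteratedDeriv 2 g z‖ := by
  rw [hf.iteratedDeriv_add hg z.2, ← mul_add]
  exact mul_le_mul_of_nonneg_left (norm_add_le _ _) (one_sub_norm_sq_nonneg z)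

theorem IsZygmund.smul_eq {f : ℂ → ℂ} (hf : IsZygmund f) (c : ℂ) (z : unitDisc) :
    (1 - ‖(z : ℂ)‖ ^ 2) * ‖iteratedDeriv 2 (c • f) z‖ =
      ‖c‖ * ((1 - ‖(z : ℂ)‖ ^ 2) * ‖iteratedDeriv 2 f z‖) := by
  rw [hf.iteratedDeriv_smul c z.2, norm_mul]
  ring

theorem IsZygmund.zero : IsZygmund 0 where
  analytic := differentiableOn_const 0
  eq_zero_off _ _ := rfl
  extends_closure := ⟨0, continuousOn_const, fun _ _ => rfl⟩
  bounded := ⟨0, by rintro _ ⟨z, rfl⟩; simp⟩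

theorem IsZygmund.add {f g : ℂ → ℂ} (hf : IsZygmund f) (hg : IsZygmund g) :
    IsZygmund (f + g) where
  analytic := hf.analytic.add hg.analytic
  eq_zero_off z hz := by simp [hf.eq_zero_off z hz, hg.eq_zero_off z hz]
  extends_closure := by
    obtain ⟨u, hu, huf⟩ := hf.extends_closure
    obtain ⟨v, hv, hvg⟩ := hg.extends_closure
    exact ⟨u + v, hu.add hv, fun z hz => by simp [huf hz, hvg hz]⟩
  bounded := by
    obtain ⟨a, ha⟩ := hf.bounded
    obtain ⟨b, hb⟩ := hg.bounded
    refine ⟨a + b, ?_⟩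
    rintro _ ⟨z, rfl⟩
    exact (hf.add_le hg z).trans (add_le_add (ha ⟨z, rfl⟩) (hb ⟨z, rfl⟩))

theorem IsZygmund.smul {f : ℂ → ℂ} (c : ℂ) (hf : IsZygmund f) : IsZygmund (c • f) where
  analytic := hf.analytic.const_smul c
  eq_zero_off z hz := by simp [hf.eq_zero_off z hz]
  extends_closure := by
    obtain ⟨u, hu, huf⟩ := hf.extends_closure
    exact ⟨c • u, hu.const_smul c, fun z hz => by simp [huf hz]⟩
  bounded := by
    obtain ⟨a, ha⟩ := hf.bounded
    refine ⟨‖c‖ * a, ?_⟩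
    rintro _ ⟨z, rfl⟩
    change (1 - ‖(z : ℂ)‖ ^ 2) * ‖iteratedDeriv 2 (c • f) z‖ ≤ _
    rw [hf.smul_eq]
    exact mul_le_mul_of_nonneg_left (ha ⟨z, rfl⟩) (norm_nonneg c)

/-- The Zygmund functions as a linear subspace of all functions. -/
def zygmundSubmodule : Submodule ℂ (ℂ → ℂ) where
  carrier := {f | IsZygmund f}
  zero_mem' := IsZygmund.zero
  add_mem' hf hg := hf.add hg
  smul_mem' c _ hf := hf.smul c

/-- The Zygmund space `𝒵`. -/
def ZygmundSpace : Type := zygmundSubmodule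

namespace ZygmundSpace

instance : AddCommGroup ZygmundSpace := inferInstanceAs (AddCommGroup zygmundSubmodule)

instance : Module ℂ ZygmundSpace := inferInstanceAs (Module ℂ zygmundSubmodule)

instance : CoeFun ZygmundSpace (fun _ => ℂ → ℂ) := ⟨fun f => f.1⟩

theorem isZygmund (f : ZygmundSpace) : IsZygmund f := f.2

theorem ext_disc {f g : ZygmundSpace} (h : ∀ z ∈ unitDisc, f z = g z) : f = g := by
  apply Subtype.ext
  funext z
  by_cases hz : z ∈ unitDisc
  · exact h z hz
  · exact (f.isZygmund.eq_zero_off z hz).trans (g.isZygmund.eq_zero_off z hz).symm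

theorem coe_zero : ((0 : ZygmundSpace) : ℂ → ℂ) = 0 := rfl

theorem coe_add (f g : ZygmundSpace) : ((f + g : ZygmundSpace) : ℂ → ℂ) = ⇑f + ⇑g := rfl

theorem coe_smul (c : ℂ) (f : ZygmundSpace) : ((c • f : ZygmundSpace) : ℂ → ℂ) = c • ⇑f := rfl

theorem zero_mem_unitDisc : (0 : ℂ) ∈ unitDisc := by simp [unitDisc]

theorem differentiableAt (f : ZygmundSpace) {z : ℂ} (hz : z ∈ unitDisc) :
    DifferentiableAt ℂ f z :=
  f.isZygmund.analytic.differentiableAt (Metric.isOpen_ball.mem_nhds hz)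

theorem deriv_add (f g : ZygmundSpace) {z : ℂ} (hz : z ∈ unitDisc) :
    deriv (f + g : ZygmundSpace) z = deriv f z + deriv g z :=
  _root_.deriv_add (f.differentiableAt hz) (g.differentiableAt hz)

theorem deriv_smul (c : ℂ) (f : ZygmundSpace) {z : ℂ} (hz : z ∈ unitDisc) :
    deriv (c • f : ZygmundSpace) z = c * deriv f z :=
  deriv_const_smul c (f.differentiableAt hz)

/-- The norm `|f(0)| + |f'(0)| + sup_{|z|<1} (1-|z|²)|f''(z)|`. -/
noncomputable instance : Norm ZygmundSpace where
  norm f := ‖f 0‖ + ‖deriv f 0‖ + ⨆ z : unitDisc, (1 - ‖(z : ℂ)‖ ^ 2) * ‖iteratedDeriv 2 f z‖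

theorem norm_def (f : ZygmundSpace) :
    ‖f‖ = ‖f 0‖ + ‖deriv f 0‖ +
      ⨆ z : unitDisc, (1 - ‖(z : ℂ)‖ ^ 2) * ‖iteratedDeriv 2 f z‖ := rfl

theorem iSup_nonneg (f : ZygmundSpace) :
    0 ≤ ⨆ z : unitDisc, (1 - ‖(z : ℂ)‖ ^ 2) * ‖iteratedDeriv 2 f z‖ :=
  Real.iSup_nonneg fun z => mul_nonneg (one_sub_norm_sq_nonneg z) (norm_nonneg _)

theorem eq_zero_of_norm_eq_zero (f : ZygmundSpace) (h : ‖f‖ = 0) : f = 0 := by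
  rw [norm_def] at h
  have h0 : ‖f 0‖ = 0 := by
    linarith [norm_nonneg (f 0), norm_nonneg (deriv f 0), f.iSup_nonneg]
  have h1 : ‖deriv f 0‖ = 0 := by
    linarith [norm_nonneg (f 0), norm_nonneg (deriv f 0), f.iSup_nonneg]
  have h2 : ⨆ z : unitDisc, (1 - ‖(z : ℂ)‖ ^ 2) * ‖iteratedDeriv 2 f z‖ = 0 := by
    linarith [norm_nonneg (f 0), norm_nonneg (deriv f 0), f.iSup_nonneg]
  have hd2 : ∀ z ∈ unitDisc, deriv (deriv f) z = 0 := by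
    intro z hz
    have hle := le_ciSup f.isZygmund.bounded ⟨z, hz⟩
    rw [h2] at hle
    have hz' : ‖z‖ < 1 := by simpa using hz
    have hpos : 0 < 1 - ‖z‖ ^ 2 := by nlinarith [norm_nonneg z]
    have hn : ‖iteratedDeriv 2 f z‖ ≤ 0 := by
      by_contra! hc
      exact absurd hle (not_le.mpr (mul_pos hpos hc))
    have := norm_le_zero_iff.mp hn
    rwa [iteratedDeriv_succ, iteratedDeriv_one] at this
  have hpre : IsPreconnected unitDisc := (convex_ball (0 : ℂ) 1).isPreconnected
  have hdf : DifferentiableOn ℂ (deriv f) unitDisc := f.isZygmund.analytic.deriv Metric.isOpen_ball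
  have hd1 : ∀ z ∈ unitDisc, deriv f z = 0 := fun z hz =>
    (Metric.isOpen_ball.is_const_of_deriv_eq_zero hpre hdf hd2 hz zero_mem_unitDisc).trans
      (norm_eq_zero.mp h1)
  exact ext_disc fun z hz =>
    (Metric.isOpen_ball.is_const_of_deriv_eq_zero hpre f.isZygmund.analytic hd1 hz
      zero_mem_unitDisc).trans (norm_eq_zero.mp h0)

theorem normedSpaceCore : NormedSpace.Core ℂ ZygmundSpace where
  norm_nonneg f := by
    rw [norm_def]
    linarith [norm_nonneg (f 0), norm_nonneg (deriv f 0), f.iSup_nonneg]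
  norm_smul c f := by
    have hs : (⨆ z : unitDisc, (1 - ‖(z : ℂ)‖ ^ 2) *
        ‖iteratedDeriv 2 (c • f : ZygmundSpace) z‖) =
        ‖c‖ * ⨆ z : unitDisc, (1 - ‖(z : ℂ)‖ ^ 2) * ‖iteratedDeriv 2 f z‖ := by
      rw [Real.mul_iSup_of_nonneg (norm_nonneg c)]
      exact iSup_congr fun z => f.isZygmund.smul_eq c z
    rw [norm_def, norm_def, hs, deriv_smul c f zero_mem_unitDisc, coe_smul]
    simp only [Pi.smul_apply, smul_eq_mul, norm_mul]
    ring
  norm_triangle f g := by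
    have hs : (⨆ z : unitDisc, (1 - ‖(z : ℂ)‖ ^ 2) *
        ‖iteratedDeriv 2 (f + g : ZygmundSpace) z‖) ≤
        (⨆ z : unitDisc, (1 - ‖(z : ℂ)‖ ^ 2) * ‖iteratedDeriv 2 f z‖) +
        ⨆ z : unitDisc, (1 - ‖(z : ℂ)‖ ^ 2) * ‖iteratedDeriv 2 g z‖ := by
      have : Nonempty unitDisc := ⟨⟨0, zero_mem_unitDisc⟩⟩
      exact ciSup_le fun z => (f.isZygmund.add_le g.isZygmund z).trans
        (add_le_add (le_ciSup f.isZygmund.bounded z) (le_ciSup g.isZygmund.bounded z))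
    rw [norm_def, norm_def, norm_def, deriv_add f g zero_mem_unitDisc, coe_add, Pi.add_apply]
    rw [← coe_add]
    linarith [norm_add_le (f 0) (g 0), norm_add_le (deriv f 0) (deriv g 0)]
  norm_eq_zero_iff f := by
    refine ⟨f.eq_zero_of_norm_eq_zero, ?_⟩
    rintro rfl
    rw [norm_def, coe_zero]
    simp

noncomputable instance : NormedAddCommGroup ZygmundSpace :=
  NormedAddCommGroup.ofCore normedSpaceCore

noncomputable instance : NormedSpace ℂ ZygmundSpace := NormedSpace.ofCore normedSpaceCore

end ZygmundSpace

/-- The little Zygmund space `𝒵₀`: the functions with `(1-|z|²)|f''(z)| → 0` as `|z| → 1⁻`. -/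
def littleZygmund : Submodule ℂ ZygmundSpace where
  carrier := {f | Filter.Tendsto (fun z : ℂ => (1 - ‖z‖ ^ 2) * ‖iteratedDeriv 2 f z‖)
    (Filter.comap (fun z : ℂ => ‖z‖) (nhdsWithin 1 (Set.Iio 1))) (nhds 0)}
  zero_mem' := by
    simpa [ZygmundSpace.coe_zero] using tendsto_const_nhds
  add_mem' {f g} hf hg := by
    have hev : ∀ᶠ z : ℂ in Filter.comap (fun z : ℂ => ‖z‖) (nhdsWithin 1 (Set.Iio 1)),
        z ∈ unitDisc := by
      refine Filter.mem_comap.mpr ⟨Set.Iio 1, self_mem_nhdsWithin, fun z hz => ?_⟩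
      simpa using hz
    have hsum := Filter.Tendsto.add hf hg
    rw [add_zero] at hsum
    refine squeeze_zero' ?_ ?_ hsum
    · filter_upwards [hev] with z hz
      exact mul_nonneg (one_sub_norm_sq_nonneg ⟨z, hz⟩) (norm_nonneg _)
    · filter_upwards [hev] with z hz
      exact f.isZygmund.add_le g.isZygmund ⟨z, hz⟩
  smul_mem' c f hf := by
    have hev : ∀ᶠ z : ℂ in Filter.comap (fun z : ℂ => ‖z‖) (nhdsWithin 1 (Set.Iio 1)),
        z ∈ unitDisc := by
      refine Filter.mem_comap.mpr ⟨Set.Iio 1, self_mem_nhdsWithin, fun z hz => ?_⟩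
      simpa using hz
    have hmul := Filter.Tendsto.const_mul ‖c‖ hf
    rw [mul_zero] at hmul
    refine hmul.congr' ?_
    filter_upwards [hev] with z hz
    exact (f.isZygmund.smul_eq c ⟨z, hz⟩).symm

/-- The space `𝒵₀^{(0,1)}` of all `f ∈ 𝒵₀` with `f(0) = f'(0) = 0`, with the norm of `𝒵`. -/
def littleZygmund01 : Submodule ℂ ZygmundSpace where
  carrier := {f | f ∈ littleZygmund ∧ f 0 = 0 ∧ deriv f 0 = 0}
  zero_mem' := ⟨littleZygmund.zero_mem, rfl, by rw [ZygmundSpace.coe_zero]; simp⟩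
  add_mem' {f g} hf hg := by
    refine ⟨littleZygmund.add_mem hf.1 hg.1, ?_, ?_⟩
    · rw [ZygmundSpace.coe_add, Pi.add_apply, hf.2.1, hg.2.1, add_zero]
    · rw [ZygmundSpace.deriv_add f g ZygmundSpace.zero_mem_unitDisc, hf.2.2, hg.2.2, add_zero]
  smul_mem' c f hf := by
    refine ⟨littleZygmund.smul_mem c hf.1, ?_, ?_⟩
    · rw [ZygmundSpace.coe_smul, Pi.smul_apply, hf.2.1, smul_zero]
    · rw [ZygmundSpace.deriv_smul c f ZygmundSpace.zero_mem_unitDisc, hf.2.2, mul_zero]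

/-- `φ` restricts to a disc automorphism: a holomorphic bijection of the open unit disc onto itself
(the values of `φ` off the disc play no role). -/
def IsDiscAutomorphism (φ : ℂ → ℂ) : Prop :=
  DifferentiableOn ℂ φ unitDisc ∧ Set.BijOn φ unitDisc unitDisc

/-- `{σ_t}` is a continuous one-parameter group of disc automorphisms. -/
structure IsContinuousAutomorphismGroup (σ : ℝ → ℂ → ℂ) : Prop where
  automorphism : ∀ t, IsDiscAutomorphism (σ t)
  map_zero : ∀ z ∈ unitDisc, σ 0 z = z
  map_add : ∀ s t, ∀ z ∈ unitDisc, σ (s + t) z = σ s (σ t z)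
  continuous : ∀ z ∈ unitDisc, Continuous fun t => σ t z

/-- `{T_t}` is a strongly continuous one-parameter group. -/
structure IsStronglyContinuousGroup {E : Type*} [NormedAddCommGroup E] [NormedSpace ℂ E]
    (T : ℝ → E ≃ₗᵢ[ℂ] E) : Prop where
  map_zero : ∀ f, T 0 f = f
  map_add : ∀ s t f, T (s + t) f = T s (T t f)
  continuous : ∀ f, Filter.Tendsto (fun t => T t f) (nhds 0) (nhds f)

/-- The complex line integral `∫_0^z g(ξ) dξ` along the segment `ξ = r z`, `0 ≤ r ≤ 1`. -/
noncomputable def segmentIntegral (g : ℂ → ℂ) (z : ℂ) : ℂ :=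
  ∫ r in (0 : ℝ)..1, g (r * z) * z

/-- `T_t f(z) = e^{iαt} ∫_0^z [f'(σ_t(ξ)) - f'(σ_t(0))] dξ` for all `t`, `f` and `|z| < 1`. -/
def IsRepresentedBy (T : ℝ → littleZygmund01 ≃ₗᵢ[ℂ] littleZygmund01) (σ : ℝ → ℂ → ℂ) (α : ℂ) :
    Prop :=
  ∀ (t : ℝ) (f : littleZygmund01), ∀ z ∈ unitDisc,
    (T t f : ZygmundSpace) z = Complex.exp (Complex.I * α * t) *
      segmentIntegral
        (fun ξ => deriv (f : ZygmundSpace) (σ t ξ) - deriv (f : ZygmundSpace) (σ t 0)) z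

open Filter Topology Metric ComplexConjugate

/-! Passing to second derivatives turns the space into holomorphic functions under the weighted sup
norm. For f in the little space, `weighted f` extends continuously by zero off the disc, so its norm
is attained. At each point `a` there is a peak function whose second derivative is the derivative of
the Möbius map `φ_a`. Its weighted modulus is `1 - |φ_a|²`, which has a quadratic maximum at `a`.
Perturbing it by a function with `f''(a) = 0` therefore raises the norm only to second order, and a
functional of norm at most one that attains its norm at the peak must be a unimodular multiple of
weighted evaluation at `a` (`apply_eq_mul_weighted`). Applied to evaluations composed with `S⁻¹`,
this gives `(Sf)'' = m · (f'' ∘ σ)` for every surjective isometry `S` (`symbol_spec`). Here `σ` is a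
disc automorphism, and equality in Schwarz–Pick together with the maximum principle forces `m = c
σ'` with `c` constant (`exists_multiplier`). Along a strongly continuous group the constants form a
continuous character of `ℝ`, hence an exponential, and integrating gives the formula. Conversely,
the isometry property at `t = ±1` makes `α` real. Strong continuity follows from uniform continuity
of `weighted f` and uniform convergence `σ_t → id`, which is read off the explicit form of `σ_t`. -/

theorem mem_unitDisc_iff {z : ℂ} : z ∈ unitDisc ↔ ‖z‖ < 1 := by simp [unitDisc]

theorem one_sub_norm_sq_pos {z : ℂ} (hz : z ∈ unitDisc) : 0 < 1 - ‖z‖ ^ 2 := by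
  have := mem_unitDisc_iff.1 hz
  nlinarith [norm_nonneg z]

theorem unitDisc_mem_nhds {z : ℂ} (hz : z ∈ unitDisc) : unitDisc ∈ 𝓝 z :=
  isOpen_ball.mem_nhds hz

theorem isPreconnected_unitDisc : IsPreconnected unitDisc := (convex_ball (0 : ℂ) 1).isPreconnected

theorem iteratedDeriv_two (f : ℂ → ℂ) : iteratedDeriv 2 f = deriv (deriv f) := by
  rw [iteratedDeriv_succ, iteratedDeriv_one]

/-! ### Second derivatives and the norm. -/

namespace ZygmundSpace

theorem differentiableOn_deriv (f : ZygmundSpace) : DifferentiableOn ℂ (deriv f) unitDisc :=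
  f.isZygmund.analytic.deriv isOpen_ball

theorem differentiableOn_secondDeriv (f : ZygmundSpace) :
    DifferentiableOn ℂ (iteratedDeriv 2 f) unitDisc := by
  rw [iteratedDeriv_two]
  exact f.differentiableOn_deriv.deriv isOpen_ball

theorem hasDerivAt_deriv (f : ZygmundSpace) {z : ℂ} (hz : z ∈ unitDisc) :
    HasDerivAt (deriv f) (iteratedDeriv 2 f z) z := by
  rw [iteratedDeriv_two]
  exact (f.differentiableOn_deriv.differentiableAt (unitDisc_mem_nhds hz)).hasDerivAt

end ZygmundSpace

namespace LittleZygmund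

/-- The second derivative of an element of `𝒵₀^{(0,1)}`. -/
noncomputable def second (f : littleZygmund01) : ℂ → ℂ := iteratedDeriv 2 (f : ZygmundSpace)

theorem apply_zero (f : littleZygmund01) : (f : ZygmundSpace) 0 = 0 := f.2.2.1

theorem deriv_zero (f : littleZygmund01) : deriv (f : ZygmundSpace) 0 = 0 := f.2.2.2

theorem hasDerivAt_deriv (f : littleZygmund01) {z : ℂ} (hz : z ∈ unitDisc) :
    HasDerivAt (deriv (f : ZygmundSpace)) (second f z) z :=
  (f : ZygmundSpace).hasDerivAt_deriv hz

theorem hasDerivAt (f : littleZygmund01) {z : ℂ} (hz : z ∈ unitDisc) :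
    HasDerivAt (f : ZygmundSpace) (deriv (f : ZygmundSpace) z) z :=
  ((f : ZygmundSpace).differentiableAt hz).hasDerivAt

theorem differentiableOn_second (f : littleZygmund01) :
    DifferentiableOn ℂ (second f) unitDisc :=
  (f : ZygmundSpace).differentiableOn_secondDeriv

theorem second_add (f g : littleZygmund01) {z : ℂ} (hz : z ∈ unitDisc) :
    second (f + g) z = second f z + second g z :=
  (f : ZygmundSpace).isZygmund.iteratedDeriv_add (g : ZygmundSpace).isZygmund hz

theorem second_smul (c : ℂ) (f : littleZygmund01) {z : ℂ} (hz : z ∈ unitDisc) :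
    second (c • f) z = c * second f z :=
  (f : ZygmundSpace).isZygmund.iteratedDeriv_smul c hz

theorem second_sub (f g : littleZygmund01) {z : ℂ} (hz : z ∈ unitDisc) :
    second (f - g) z = second f z - second g z := by
  have h : f - g = f + (-1 : ℂ) • g := by simp [sub_eq_add_neg]
  rw [h, second_add _ _ hz, second_smul _ _ hz]
  ring

theorem norm_eq (f : littleZygmund01) :
    ‖f‖ = ⨆ z : unitDisc, (1 - ‖(z : ℂ)‖ ^ 2) * ‖second f z‖ := by
  change ‖(f : ZygmundSpace)‖ = _
  rw [ZygmundSpace.norm_def, apply_zero, deriv_zero]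
  simp [second]

theorem le_norm (f : littleZygmund01) {z : ℂ} (hz : z ∈ unitDisc) :
    (1 - ‖z‖ ^ 2) * ‖second f z‖ ≤ ‖f‖ := by
  rw [norm_eq]
  exact le_ciSup (f : ZygmundSpace).isZygmund.bounded ⟨z, hz⟩

theorem norm_le {f : littleZygmund01} {C : ℝ}
    (h : ∀ z ∈ unitDisc, (1 - ‖z‖ ^ 2) * ‖second f z‖ ≤ C) : ‖f‖ ≤ C := by
  rw [norm_eq]
  have : Nonempty unitDisc := ⟨⟨0, ZygmundSpace.zero_mem_unitDisc⟩⟩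
  exact ciSup_le fun z => h z z.2

theorem ext_second {f g : littleZygmund01} (h : ∀ z ∈ unitDisc, second f z = second g z) :
    f = g := by
  rw [← sub_eq_zero, ← norm_le_zero_iff]
  refine norm_le fun z hz => ?_
  rw [second_sub _ _ hz, h z hz]
  simp

theorem tendsto_second {ι : Type*} {l : Filter ι} {F : ι → littleZygmund01} {f : littleZygmund01}
    (h : Tendsto F l (𝓝 f)) {z : ℂ} (hz : z ∈ unitDisc) :
    Tendsto (fun i => second (F i) z) l (𝓝 (second f z)) := by
  rw [tendsto_iff_norm_sub_tendsto_zero] at h ⊢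
  have hpos := one_sub_norm_sq_pos hz
  refine squeeze_zero (fun _ => norm_nonneg _) (fun i => ?_)
    (by simpa using h.const_mul (1 - ‖z‖ ^ 2)⁻¹)
  rw [← second_sub _ _ hz, ← div_eq_inv_mul, le_div_iff₀ hpos, mul_comm]
  exact le_norm _ hz

/-! ### The weighted second derivative as a compactly supported continuous function. -/

/-- The weighted second derivative `(1-|z|²) f''(z)`, which vanishes off the disc. -/
noncomputable def weighted (f : littleZygmund01) (z : ℂ) : ℂ :=
  ((1 - ‖z‖ ^ 2 : ℝ) : ℂ) * second f z

theorem norm_weighted (f : littleZygmund01) {z : ℂ} (hz : z ∈ unitDisc) :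
    ‖weighted f z‖ = (1 - ‖z‖ ^ 2) * ‖second f z‖ := by
  rw [weighted, norm_mul, Complex.norm_real, Real.norm_of_nonneg (one_sub_norm_sq_pos hz).le]

/-- On the circle the weight vanishes, whatever value `second f` takes there; outside the closed
disc `f` is locally zero. -/
theorem weighted_eq_zero (f : littleZygmund01) {z : ℂ} (hz : z ∉ unitDisc) : weighted f z = 0 := by
  rw [mem_unitDisc_iff, not_lt] at hz
  rcases hz.eq_or_lt with h | h
  · simp [weighted, ← h]
  · have hev : (f : ZygmundSpace).1 =ᶠ[𝓝 z] fun _ => 0 := by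
      filter_upwards [continuous_norm.continuousAt.eventually (lt_mem_nhds h)] with w hw
      exact (f : ZygmundSpace).isZygmund.eq_zero_off w (by simpa using hw.le)
    have : second f z = 0 := by
      unfold second
      rw [hev.iteratedDeriv_eq 2]
      simp
    simp [weighted, this]

theorem norm_weighted_le (f : littleZygmund01) (z : ℂ) : ‖weighted f z‖ ≤ ‖f‖ := by
  by_cases hz : z ∈ unitDisc
  · rw [norm_weighted f hz]
    exact le_norm f hz
  · rw [weighted_eq_zero f hz]
    simp

theorem exists_radius (f : littleZygmund01) {ε : ℝ} (hε : 0 < ε) :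
    ∃ r < 1, ∀ z, r < ‖z‖ → ‖weighted f z‖ < ε := by
  have h : Tendsto (fun z : ℂ => (1 - ‖z‖ ^ 2) * ‖second f z‖)
    (comap (fun z : ℂ => ‖z‖) (𝓝[<] 1)) (𝓝 0) := f.2.1
  have h2 := h.eventually (gt_mem_nhds hε)
  rw [eventually_comap] at h2
  obtain ⟨r, hr, hr'⟩ := (mem_nhdsLT_iff_exists_Ioo_subset).1 h2
  refine ⟨r, hr, fun z hz => ?_⟩
  by_cases hz1 : z ∈ unitDisc
  · rw [norm_weighted f hz1]
    exact hr' ⟨hz, mem_unitDisc_iff.1 hz1⟩ z rfl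
  · simpa [weighted_eq_zero f hz1] using hε

theorem continuous_weighted (f : littleZygmund01) : Continuous (weighted f) := by
  rw [continuous_iff_continuousAt]
  intro z
  by_cases hz : z ∈ unitDisc
  · refine ContinuousAt.mul (by fun_prop) ?_
    exact ((differentiableOn_second f).differentiableAt (unitDisc_mem_nhds hz)).continuousAt
  · rw [ContinuousAt, weighted_eq_zero f hz, Metric.tendsto_nhds]
    intro ε hε
    obtain ⟨r, hr, h⟩ := exists_radius f hε
    have : r < ‖z‖ := by
      rw [mem_unitDisc_iff] at hz
      linarith
    filter_upwards [continuous_norm.continuousAt.eventually (lt_mem_nhds this)] with w hw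
    simpa using h w hw

theorem hasCompactSupport_weighted (f : littleZygmund01) : HasCompactSupport (weighted f) := by
  refine HasCompactSupport.intro (isCompact_closedBall (0 : ℂ) 1) fun z hz => ?_
  refine weighted_eq_zero f fun h => hz (ball_subset_closedBall h)

theorem uniformContinuous_weighted (f : littleZygmund01) : UniformContinuous (weighted f) :=
  (hasCompactSupport_weighted f).uniformContinuous_of_continuous (continuous_weighted f)

/-- The little-space condition makes `weighted f` continuous with compact support, so the supremum
is a maximum. -/
theorem exists_norm_weighted_eq (f : littleZygmund01) :
    ∃ z ∈ unitDisc, ‖weighted f z‖ = ‖f‖ := by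
  obtain ⟨z, hz⟩ := (continuous_weighted f).norm.exists_forall_ge_of_hasCompactSupport
    (hasCompactSupport_weighted f).norm
  have hle : ‖f‖ ≤ ‖weighted f z‖ := norm_le fun w hw => by
    rw [← norm_weighted f hw]
    exact hz w
  by_cases hz1 : z ∈ unitDisc
  · exact ⟨z, hz1, (norm_weighted_le f z).antisymm hle⟩
  -- A maximum attained off the disc forces the norm to be zero, and then any point serves.
  · refine ⟨0, ZygmundSpace.zero_mem_unitDisc, (norm_weighted_le f 0).antisymm (hle.trans ?_)⟩
    rw [weighted_eq_zero f hz1]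
    simp

/-- Integrate twice from 0 and cut off outside the disc. Holomorphy past the closed disc bounds `g`
there, so the weight alone drives the product to zero at the circle. -/
theorem exists_second_eq {g : ℂ → ℂ} {R : ℝ} (hR : 1 < R)
    (hg : DifferentiableOn ℂ g (ball 0 R)) :
    ∃ f : littleZygmund01, ∀ z ∈ unitDisc, second f z = g z := by
  obtain ⟨h, hh0, hh⟩ := hg.isExactOn_ball.with_val_at 0 0
  have hhd : DifferentiableOn ℂ h (ball 0 R) :=
    fun z hz => (hh z hz).differentiableAt.differentiableWithinAt
  obtain ⟨k, hk0, hk⟩ := hhd.isExactOn_ball.with_val_at 0 0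
  have hsub : closedBall (0 : ℂ) 1 ⊆ ball 0 R := closedBall_subset_ball hR
  have hsub' : unitDisc ⊆ ball 0 R := ball_subset_closedBall.trans hsub
  set F : ℂ → ℂ := unitDisc.indicator k with hF
  have hFk : ∀ z ∈ unitDisc, F =ᶠ[𝓝 z] k := fun z hz => by
    filter_upwards [unitDisc_mem_nhds hz] with w hw using Set.indicator_of_mem hw k
  have hF1 : ∀ z ∈ unitDisc, deriv F z = h z := fun z hz =>
    (hFk z hz).deriv_eq.trans (hk z (hsub' hz)).deriv
  have hF2 : ∀ z ∈ unitDisc, iteratedDeriv 2 F z = g z := fun z hz => by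
    rw [iteratedDeriv_two]
    have : deriv F =ᶠ[𝓝 z] h := by
      filter_upwards [unitDisc_mem_nhds hz] with w hw using hF1 w hw
    exact this.deriv_eq.trans (hh z (hsub' hz)).deriv
  obtain ⟨M, hM⟩ := (isCompact_closedBall (0 : ℂ) 1).exists_bound_of_continuousOn
    (hg.continuousOn.mono hsub)
  have hZ : IsZygmund F := by
    refine ⟨fun z hz => ?_, fun z hz => Set.indicator_of_notMem hz k, ⟨k, fun z hz => ?_, ?_⟩,
      ⟨M, ?_⟩⟩
    · exact ((hFk z hz).differentiableAt_iff.2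
        (hk z (hsub' hz)).differentiableAt).differentiableWithinAt
    · exact (hk z (hsub hz)).continuousAt.continuousWithinAt
    · exact fun z hz => (Set.indicator_of_mem hz k).symm
    · rintro _ ⟨z, rfl⟩
      have h1 := hM z (ball_subset_closedBall z.2)
      have h2 := one_sub_norm_sq_pos z.2
      simp only [hF2 z z.2]
      nlinarith [norm_nonneg (g z), sq_nonneg ‖(z : ℂ)‖]
  let f : ZygmundSpace := ⟨F, hZ⟩
  have hmem : f ∈ littleZygmund01 := by
    refine ⟨?_, (hFk 0 ZygmundSpace.zero_mem_unitDisc).eq_of_nhds.trans hk0,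
      (hF1 0 ZygmundSpace.zero_mem_unitDisc).trans hh0⟩
    change Tendsto (fun z : ℂ => (1 - ‖z‖ ^ 2) * ‖iteratedDeriv 2 F z‖) _ _
    have hev : ∀ᶠ z : ℂ in comap (fun z : ℂ => ‖z‖) (𝓝[<] 1), z ∈ unitDisc :=
      mem_comap.mpr ⟨Set.Iio 1, self_mem_nhdsWithin, fun z hz => by simpa using hz⟩
    have hlim : Tendsto (fun z : ℂ => (1 - ‖z‖ ^ 2) * M) (comap (fun z : ℂ => ‖z‖) (𝓝[<] 1))
        (𝓝 0) := by
      have : Tendsto (fun r : ℝ => (1 - r ^ 2) * M) (𝓝[<] 1) (𝓝 ((1 - 1 ^ 2) * M)) :=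
        (Continuous.tendsto (by fun_prop) 1).mono_left nhdsWithin_le_nhds
      rw [one_pow, sub_self, zero_mul] at this
      exact this.comp tendsto_comap
    refine squeeze_zero' ?_ ?_ hlim
    · filter_upwards [hev] with z hz
      exact mul_nonneg (one_sub_norm_sq_pos hz).le (norm_nonneg _)
    · filter_upwards [hev] with z hz
      rw [hF2 z hz]
      exact mul_le_mul_of_nonneg_left (hM z (ball_subset_closedBall hz))
        (one_sub_norm_sq_pos hz).le
  exact ⟨⟨f, hmem⟩, hF2⟩

end LittleZygmund

/-! ### Möbius maps and the classification of disc automorphisms. -/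

/-- The disc automorphism `z ↦ (z - a) / (1 - ā z)`. -/
noncomputable def mobius (a z : ℂ) : ℂ := (z - a) / (1 - conj a * z)

theorem one_sub_conj_mul_ne_zero {a z : ℂ} (h : ‖a‖ * ‖z‖ < 1) : 1 - conj a * z ≠ 0 := by
  intro h0
  have : ‖conj a * z‖ = 1 := by rw [← sub_eq_zero.1 h0, norm_one]
  rw [norm_mul, RCLike.norm_conj] at this
  linarith

theorem norm_mul_norm_lt_one {a z : ℂ} (ha : a ∈ unitDisc) (hz : z ∈ unitDisc) :
    ‖a‖ * ‖z‖ < 1 := by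
  rw [mem_unitDisc_iff] at ha hz
  nlinarith [norm_nonneg a, norm_nonneg z]

theorem one_sub_conj_mul_ne_zero_of_mem {a z : ℂ} (ha : a ∈ unitDisc) (hz : z ∈ unitDisc) :
    1 - conj a * z ≠ 0 :=
  one_sub_conj_mul_ne_zero (norm_mul_norm_lt_one ha hz)

theorem one_sub_norm_mobius_sq {a z : ℂ} (h : 1 - conj a * z ≠ 0) :
    1 - ‖mobius a z‖ ^ 2 = (1 - ‖a‖ ^ 2) * (1 - ‖z‖ ^ 2) / ‖1 - conj a * z‖ ^ 2 := by
  have h' : ‖1 - conj a * z‖ ≠ 0 := norm_ne_zero_iff.2 h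
  have key : ‖1 - conj a * z‖ ^ 2 - ‖z - a‖ ^ 2 = (1 - ‖a‖ ^ 2) * (1 - ‖z‖ ^ 2) := by
    simp only [← Complex.normSq_eq_norm_sq, Complex.normSq_apply, Complex.sub_re, Complex.sub_im,
      Complex.mul_re, Complex.mul_im, Complex.conj_re, Complex.conj_im, Complex.one_re,
      Complex.one_im]
    ring
  rw [mobius, norm_div, div_pow, ← key, sub_div, div_self (pow_ne_zero 2 h')]

theorem mobius_mem {a z : ℂ} (ha : a ∈ unitDisc) (hz : z ∈ unitDisc) : mobius a z ∈ unitDisc := by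
  have h := one_sub_conj_mul_ne_zero_of_mem ha hz
  have h1 : 0 < 1 - ‖mobius a z‖ ^ 2 := by
    rw [one_sub_norm_mobius_sq h]
    have := norm_pos_iff.2 h
    have := one_sub_norm_sq_pos ha
    have := one_sub_norm_sq_pos hz
    positivity
  rw [mem_unitDisc_iff]
  nlinarith [norm_nonneg (mobius a z)]

theorem neg_mem_unitDisc {a : ℂ} (ha : a ∈ unitDisc) : -a ∈ unitDisc := by
  simpa [mem_unitDisc_iff] using ha

theorem mobius_neg_mobius {a z : ℂ} (ha : a ∈ unitDisc) (hz : z ∈ unitDisc) :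
    mobius (-a) (mobius a z) = z := by
  have h := one_sub_conj_mul_ne_zero_of_mem ha hz
  have h2 := one_sub_conj_mul_ne_zero_of_mem ha ha
  have h3 : 1 - conj (-a) * mobius a z = (1 - conj a * a) / (1 - conj a * z) := by
    rw [mobius, map_neg]
    field_simp
    ring
  have h4 : mobius a z - -a = z * (1 - conj a * a) / (1 - conj a * z) := by
    rw [mobius, eq_div_iff h, sub_neg_eq_add, add_mul, div_mul_cancel₀ _ h]
    ring
  rw [mobius, h3, h4, div_div_div_cancel_right₀ h, mul_div_cancel_right₀ _ h2]

theorem hasDerivAt_mobius {a z : ℂ} (h : 1 - conj a * z ≠ 0) :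
    HasDerivAt (mobius a) ((1 - conj a * a) / (1 - conj a * z) ^ 2) z := by
  have h1 : HasDerivAt (fun z => z - a) 1 z := (hasDerivAt_id z).sub_const a
  have h2 : HasDerivAt (fun z => 1 - conj a * z) (-(conj a * 1)) z :=
    ((hasDerivAt_id z).const_mul (conj a)).const_sub 1
  refine (h1.div h2 h).congr_deriv ?_
  congr 1
  ring

theorem differentiableOn_mobius {a : ℂ} (ha : a ∈ unitDisc) :
    DifferentiableOn ℂ (mobius a) unitDisc := fun _ hz =>
  (hasDerivAt_mobius
    (one_sub_conj_mul_ne_zero_of_mem ha hz)).differentiableAt.differentiableWithinAt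

theorem one_sub_conj_mul_self (a : ℂ) : 1 - conj a * a = ((1 - ‖a‖ ^ 2 : ℝ) : ℂ) := by
  rw [mul_comm, Complex.mul_conj, Complex.normSq_eq_norm_sq]
  push_cast
  ring

theorem weight_mul_norm_mobius_deriv {a z : ℂ} (ha : a ∈ unitDisc) (hz : z ∈ unitDisc) :
    (1 - ‖z‖ ^ 2) * ‖(1 - conj a * a) / (1 - conj a * z) ^ 2‖ = 1 - ‖mobius a z‖ ^ 2 := by
  rw [one_sub_norm_mobius_sq (one_sub_conj_mul_ne_zero_of_mem ha hz), one_sub_conj_mul_self,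
    norm_div, Complex.norm_real, Real.norm_of_nonneg (one_sub_norm_sq_pos ha).le, norm_pow]
  ring

theorem half_norm_sub_le_norm_mobius {a z : ℂ} (ha : a ∈ unitDisc) (hz : z ∈ unitDisc) :
    ‖z - a‖ / 2 ≤ ‖mobius a z‖ := by
  have h := norm_pos_iff.2 (one_sub_conj_mul_ne_zero_of_mem ha hz)
  have h2 : ‖1 - conj a * z‖ ≤ 2 := by
    refine (norm_sub_le _ _).trans ?_
    rw [norm_mul, RCLike.norm_conj, norm_one]
    linarith [norm_mul_norm_lt_one ha hz]
  rw [mobius, norm_div]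
  gcongr

/-- Mutually inverse holomorphic self-maps of the disc. -/
structure AreInverseOnDisc (σ τ : ℂ → ℂ) : Prop where
  differentiableOn : DifferentiableOn ℂ σ unitDisc
  differentiableOn_inv : DifferentiableOn ℂ τ unitDisc
  mapsTo : Set.MapsTo σ unitDisc unitDisc
  mapsTo_inv : Set.MapsTo τ unitDisc unitDisc
  leftInv : ∀ z ∈ unitDisc, τ (σ z) = z
  rightInv : ∀ z ∈ unitDisc, σ (τ z) = z

theorem norm_le_norm_of_mapsTo_unitDisc {s : ℂ → ℂ} (hs : DifferentiableOn ℂ s unitDisc)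
    (hm : Set.MapsTo s unitDisc unitDisc) (h0 : s 0 = 0) {z : ℂ} (hz : z ∈ unitDisc) :
    ‖s z‖ ≤ ‖z‖ :=
  Complex.norm_le_norm_of_mapsTo_ball hs (hm.mono_right ball_subset_closedBall) h0
    (mem_unitDisc_iff.1 hz)

/-- The Schwarz lemma for both maps gives `|σ z| = |z|`, and its equality case, tested at the
arbitrary nonzero point `1/2`, makes `σ` a rotation. -/
theorem AreInverseOnDisc.eq_mul_of_map_zero {σ τ : ℂ → ℂ} (h : AreInverseOnDisc σ τ)
    (h0 : σ 0 = 0) : ∃ μ : ℂ, ‖μ‖ = 1 ∧ ∀ z ∈ unitDisc, σ z = μ * z := by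
  have h0' : τ 0 = 0 := by
    simpa [h0] using h.leftInv 0 ZygmundSpace.zero_mem_unitDisc
  have hn : ∀ z ∈ unitDisc, ‖σ z‖ = ‖z‖ := fun z hz => by
    refine (norm_le_norm_of_mapsTo_unitDisc h.differentiableOn h.mapsTo h0 hz).antisymm ?_
    conv_lhs => rw [← h.leftInv z hz]
    exact norm_le_norm_of_mapsTo_unitDisc h.differentiableOn_inv h.mapsTo_inv h0' (h.mapsTo hz)
  have hhalf : (1 / 2 : ℂ) ∈ unitDisc := by
    rw [mem_unitDisc_iff]; norm_num
  have hslope : ∀ z ∈ unitDisc, z ≠ 0 → ‖dslope σ 0 z‖ = 1 := fun z hz hz0 => by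
    rw [dslope_of_ne _ hz0, slope_def_field, h0, sub_zero, sub_zero, norm_div, hn z hz]
    exact div_self (norm_ne_zero_iff.2 hz0)
  have haff := Complex.affine_of_mapsTo_ball_of_norm_dslope_eq_div h.differentiableOn
    (by rw [h0]; exact h.mapsTo.mono_right ball_subset_closedBall) hhalf
    (by rw [hslope _ hhalf (by norm_num)]; norm_num)
  refine ⟨dslope σ 0 (1 / 2), hslope _ hhalf (by norm_num), fun z hz => ?_⟩
  have := haff hz
  simp only [h0, sub_zero, zero_add, smul_eq_mul] at this
  rw [this, mul_comm]

theorem AreInverseOnDisc.eq_mobius {σ τ : ℂ → ℂ} (h : AreInverseOnDisc σ τ) :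
    ∃ μ : ℂ, ‖μ‖ = 1 ∧ ∀ z ∈ unitDisc, σ z = μ * mobius (τ 0) z := by
  set a := τ 0 with ha_def
  have ha : a ∈ unitDisc := h.mapsTo_inv ZygmundSpace.zero_mem_unitDisc
  have ha' := neg_mem_unitDisc ha
  have hinv : AreInverseOnDisc (fun z => σ (mobius (-a) z)) (fun z => mobius a (τ z)) := by
    refine ⟨h.differentiableOn.comp (differentiableOn_mobius ha') fun z hz => mobius_mem ha' hz,
      (differentiableOn_mobius ha).comp h.differentiableOn_inv h.mapsTo_inv,
      fun z hz => h.mapsTo (mobius_mem ha' hz), fun z hz => mobius_mem ha (h.mapsTo_inv hz),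
      fun z hz => ?_, fun z hz => ?_⟩
    · have := mobius_neg_mobius ha' hz
      rw [neg_neg] at this
      simp only [h.leftInv _ (mobius_mem ha' hz), this]
    · simp only [mobius_neg_mobius ha (h.mapsTo_inv hz), h.rightInv z hz]
  obtain ⟨μ, hμ, hs⟩ := hinv.eq_mul_of_map_zero (by
    have : mobius (-a) 0 = a := by simp [mobius]
    simp only [this]
    exact h.rightInv 0 ZygmundSpace.zero_mem_unitDisc)
  refine ⟨μ, hμ, fun z hz => ?_⟩
  rw [← hs _ (mobius_mem ha hz), mobius_neg_mobius ha hz]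

theorem AreInverseOnDisc.isDiscAutomorphism {σ τ : ℂ → ℂ} (h : AreInverseOnDisc σ τ) :
    IsDiscAutomorphism σ :=
  ⟨h.differentiableOn, Set.InvOn.bijOn ⟨h.leftInv, h.rightInv⟩ h.mapsTo h.mapsTo_inv⟩

theorem deriv_mul_mobius {σ : ℂ → ℂ} {μ a : ℂ} (ha : a ∈ unitDisc)
    (h : ∀ z ∈ unitDisc, σ z = μ * mobius a z) {z : ℂ} (hz : z ∈ unitDisc) :
    deriv σ z = μ * ((1 - conj a * a) / (1 - conj a * z) ^ 2) := by
  have hev : σ =ᶠ[𝓝 z] fun w => μ * mobius a w := by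
    filter_upwards [unitDisc_mem_nhds hz] with w hw using h w hw
  rw [hev.deriv_eq]
  exact ((hasDerivAt_mobius (one_sub_conj_mul_ne_zero_of_mem ha hz)).const_mul μ).deriv

/-- Equality in Schwarz–Pick, from the explicit form of `σ`. -/
theorem AreInverseOnDisc.weight_mul_norm_deriv {σ τ : ℂ → ℂ} (h : AreInverseOnDisc σ τ) {z : ℂ}
    (hz : z ∈ unitDisc) : (1 - ‖z‖ ^ 2) * ‖deriv σ z‖ = 1 - ‖σ z‖ ^ 2 := by
  obtain ⟨μ, hμ, hs⟩ := h.eq_mobius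
  have ha := h.mapsTo_inv ZygmundSpace.zero_mem_unitDisc
  rw [deriv_mul_mobius ha hs hz, norm_mul, hμ, one_mul, weight_mul_norm_mobius_deriv ha hz,
    hs z hz, norm_mul, hμ, one_mul]

theorem AreInverseOnDisc.deriv_ne_zero {σ τ : ℂ → ℂ} (h : AreInverseOnDisc σ τ) {z : ℂ}
    (hz : z ∈ unitDisc) : deriv σ z ≠ 0 := by
  intro h0
  have h1 := h.weight_mul_norm_deriv hz
  rw [h0, norm_zero, mul_zero] at h1
  linarith [one_sub_norm_sq_pos (h.mapsTo hz)]

/-! ### Peak functions and the action of isometries on evaluations. -/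

namespace LittleZygmund

theorem exists_second_eq_deriv_mobius {a : ℂ} (ha : a ∈ unitDisc) :
    ∃ g : littleZygmund01, ∀ z ∈ unitDisc,
      second g z = (1 - conj a * a) / (1 - conj a * z) ^ 2 := by
  have ha1 := mem_unitDisc_iff.1 ha
  have hpos : 0 < 1 + ‖a‖ := by positivity
  -- This radius exceeds 1, while `|a| R < 1` keeps the pole outside the ball.
  refine exists_second_eq (R := 2 / (1 + ‖a‖)) ?_ fun z hz => ?_
  · rw [lt_div_iff₀ hpos]
    linarith
  · have hz' : ‖z‖ * (1 + ‖a‖) < 2 := by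
      rw [mem_ball_zero_iff, lt_div_iff₀ hpos] at hz
      exact hz
    have hne : 1 - conj a * z ≠ 0 := by
      refine one_sub_conj_mul_ne_zero ?_
      by_contra! hc
      nlinarith [norm_nonneg a, norm_nonneg z]
    refine DifferentiableAt.differentiableWithinAt ?_
    exact (differentiableAt_const _).div
      (((differentiableAt_const _).sub
        ((differentiableAt_const _).mul differentiableAt_id)).pow 2) (pow_ne_zero 2 hne)

/-- The peak function at `a`, whose second derivative is the derivative of `mobius a`. -/
noncomputable def peak (a : ℂ) (ha : a ∈ unitDisc) : littleZygmund01 :=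
  (exists_second_eq_deriv_mobius ha).choose

theorem second_peak {a : ℂ} (ha : a ∈ unitDisc) {z : ℂ} (hz : z ∈ unitDisc) :
    second (peak a ha) z = (1 - conj a * a) / (1 - conj a * z) ^ 2 :=
  (exists_second_eq_deriv_mobius ha).choose_spec z hz

theorem weight_mul_second_peak {a : ℂ} (ha : a ∈ unitDisc) {z : ℂ} (hz : z ∈ unitDisc) :
    (1 - ‖z‖ ^ 2) * ‖second (peak a ha) z‖ = 1 - ‖mobius a z‖ ^ 2 := by
  rw [second_peak ha hz, weight_mul_norm_mobius_deriv ha hz]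

theorem weighted_peak_self {a : ℂ} (ha : a ∈ unitDisc) : weighted (peak a ha) a = 1 := by
  rw [weighted, second_peak ha ha, ← one_sub_conj_mul_self]
  have := one_sub_conj_mul_ne_zero_of_mem ha ha
  rw [mul_div_assoc', ← pow_two, div_self (pow_ne_zero 2 this)]

theorem norm_peak {a : ℂ} (ha : a ∈ unitDisc) : ‖peak a ha‖ = 1 := by
  refine le_antisymm (norm_le fun z hz => ?_) ?_
  · rw [weight_mul_second_peak ha hz]
    linarith [sq_nonneg ‖mobius a z‖]
  · simpa [weighted_peak_self ha] using norm_weighted_le (peak a ha) a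

/-- Near `a`, factor out `z - a` with a bounded quotient; away from `a`, use the norm of `f`. Then
compare `|z - a|` with the modulus of the Möbius map. -/
theorem exists_norm_weighted_le_of_eq_zero {a : ℂ} (ha : a ∈ unitDisc) {f : littleZygmund01}
    (hf : second f a = 0) :
    ∃ C : ℝ, ∀ z ∈ unitDisc, (1 - ‖z‖ ^ 2) * ‖second f z‖ ≤ C * ‖mobius a z‖ := by
  obtain ⟨δ, hδ, hball⟩ := nhds_basis_closedBall.mem_iff.1 (unitDisc_mem_nhds ha)
  have hcont : ContinuousOn (dslope (second f) a) (closedBall a δ) :=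
    ((continuousOn_dslope (unitDisc_mem_nhds ha)).2 ⟨(differentiableOn_second f).continuousOn,
      (differentiableOn_second f).differentiableAt (unitDisc_mem_nhds ha)⟩).mono hball
  obtain ⟨M, hM⟩ := (isCompact_closedBall a δ).exists_bound_of_continuousOn hcont
  have hM0 : 0 ≤ M := (norm_nonneg _).trans (hM a (mem_closedBall_self hδ.le))
  refine ⟨2 * (M + ‖f‖ / δ), fun z hz => ?_⟩
  have hhalf := half_norm_sub_le_norm_mobius ha hz
  have hv := one_sub_norm_sq_pos hz
  have hq : 0 ≤ ‖f‖ / δ := by positivity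
  suffices h : (1 - ‖z‖ ^ 2) * ‖second f z‖ ≤ (M + ‖f‖ / δ) * ‖z - a‖ by
    calc _ ≤ (M + ‖f‖ / δ) * ‖z - a‖ := h
      _ = 2 * (M + ‖f‖ / δ) * (‖z - a‖ / 2) := by ring
      _ ≤ _ := by gcongr
  by_cases hzδ : z ∈ closedBall a δ
  · have h1 : second f z = (z - a) * dslope (second f) a z := by
      rw [← smul_eq_mul, sub_smul_dslope, hf, sub_zero]
    have h2 := hM z hzδ
    calc _ ≤ 1 * ‖second f z‖ := by gcongr; linarith [sq_nonneg ‖z‖]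
      _ = ‖z - a‖ * ‖dslope (second f) a z‖ := by rw [one_mul, h1, norm_mul]
      _ ≤ ‖z - a‖ * (M + ‖f‖ / δ) := by gcongr; linarith
      _ = _ := mul_comm _ _
  · have hd : δ ≤ ‖z - a‖ := by
      rw [mem_closedBall, dist_eq_norm, not_le] at hzδ
      exact hzδ.le
    calc _ ≤ ‖f‖ := le_norm f hz
      _ = ‖f‖ / δ * δ := by field_simp
      _ ≤ (M + ‖f‖ / δ) * ‖z - a‖ := by gcongr; linarith

/-- With `m = |φ_a(z)|` the weighted modulus is at most `1 - m² + C|ε|m`; completing the square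
leaves `1 + C²|ε|²/4`, with no first-order term. -/
theorem norm_peak_add_smul_le {a : ℂ} (ha : a ∈ unitDisc) {f : littleZygmund01}
    (hf : second f a = 0) :
    ∃ C : ℝ, ∀ ε : ℂ, ‖peak a ha + ε • f‖ ≤ 1 + C * ‖ε‖ ^ 2 := by
  obtain ⟨C, hC⟩ := exists_norm_weighted_le_of_eq_zero ha hf
  refine ⟨C ^ 2 / 4, fun ε => norm_le fun z hz => ?_⟩
  have hv := (one_sub_norm_sq_pos hz).le
  rw [second_add _ _ hz, second_smul _ _ hz]
  have h1 := weight_mul_second_peak ha hz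
  calc _ ≤ (1 - ‖z‖ ^ 2) * (‖second (peak a ha) z‖ + ‖ε‖ * ‖second f z‖) := by
        gcongr
        exact (norm_add_le _ _).trans (by rw [norm_mul])
    _ = 1 - ‖mobius a z‖ ^ 2 + ‖ε‖ * ((1 - ‖z‖ ^ 2) * ‖second f z‖) := by rw [← h1]; ring
    _ ≤ 1 - ‖mobius a z‖ ^ 2 + ‖ε‖ * (C * ‖mobius a z‖) := by
        linarith [mul_le_mul_of_nonneg_left (hC z hz) (norm_nonneg ε)]
    _ ≤ _ := by nlinarith [sq_nonneg (‖mobius a z‖ - C * ‖ε‖ / 2)]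

/-- A functional of norm at most one that attains its norm at the peak function at `a` annihilates
everything whose second derivative vanishes at `a`. -/
theorem apply_eq_zero_of_second_eq_zero {a : ℂ} (ha : a ∈ unitDisc)
    (l : littleZygmund01 →ₗ[ℂ] ℂ) (hl : ∀ f, ‖l f‖ ≤ ‖f‖) (hp : ‖l (peak a ha)‖ = 1)
    {f : littleZygmund01} (hf : second f a = 0) : l f = 0 := by
  by_contra hne
  obtain ⟨C, hC⟩ := norm_peak_add_smul_le ha hf
  have hpos : 0 < ‖l f‖ := norm_pos_iff.2 hne
  set K := |C| / ‖l f‖ ^ 2 with hK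
  have hK0 : 0 ≤ K := by positivity
  have key : ∀ s : ℝ, 0 < s → s ≤ K * s ^ 2 := fun s hs => by
    -- This phase and size of the perturbation align `l f` with `l` of the peak, so the value has
    -- modulus exactly `1 + s`.
    have h1 := (hl _).trans (hC (s * (l (peak a ha) / l f)))
    have h2 : l (peak a ha + (s * (l (peak a ha) / l f)) • f) = (1 + s : ℝ) * l (peak a ha) := by
      rw [map_add, map_smul, smul_eq_mul, mul_assoc, div_mul_cancel₀ _ hne]
      push_cast
      ring
    rw [h2, norm_mul, norm_mul, norm_div, hp, Complex.norm_real, Complex.norm_real,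
      Real.norm_of_nonneg hs.le, Real.norm_of_nonneg (by linarith)] at h1
    have h3 : C * (s * (1 / ‖l f‖)) ^ 2 ≤ K * s ^ 2 := by
      rw [hK, mul_pow, div_pow, one_pow, div_mul_eq_mul_div, mul_one_div, mul_div_assoc']
      gcongr
      exact le_abs_self C
    linarith
  -- Any small `s` contradicts `s ≤ K s²`; this one satisfies `K s < 1`.
  have h := key (1 / (K + 1)) (by positivity)
  have h2 : K * (1 / (K + 1)) ^ 2 < 1 / (K + 1) := by
    rw [div_pow, one_pow, mul_one_div, div_lt_div_iff₀ (by positivity) (by positivity)]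
    nlinarith
  linarith

/-- Subtracting the multiple `weighted f a` of the peak kills the second derivative at `a`, because
the peak has weighted value 1 there. -/
theorem apply_eq_mul_weighted {a : ℂ} (ha : a ∈ unitDisc)
    (l : littleZygmund01 →ₗ[ℂ] ℂ) (hl : ∀ f, ‖l f‖ ≤ ‖f‖) (hp : ‖l (peak a ha)‖ = 1)
    (f : littleZygmund01) : l f = l (peak a ha) * weighted f a := by
  have h0 : second (f - weighted f a • peak a ha) a = 0 := by
    have h1 := weighted_peak_self ha
    rw [second_sub _ _ ha, second_smul _ _ ha, weighted]
    rw [weighted] at h1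
    linear_combination (-second f a) * h1
  have h := apply_eq_zero_of_second_eq_zero ha l hl hp h0
  rw [map_sub, map_smul, smul_eq_mul, sub_eq_zero] at h
  rw [h, mul_comm]

/-- Evaluation of the weighted second derivative. -/
noncomputable def weightedEval (z : ℂ) (hz : z ∈ unitDisc) : littleZygmund01 →ₗ[ℂ] ℂ where
  toFun f := weighted f z
  map_add' f g := by simp only [weighted, second_add _ _ hz, mul_add]
  map_smul' c f := by
    simp only [weighted, second_smul _ _ hz, smul_eq_mul, RingHom.id_apply]
    ring

/-- A surjective isometry carries point evaluations to unimodular multiples of point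
evaluations. -/
theorem exists_weighted_isometry (S : littleZygmund01 ≃ₗᵢ[ℂ] littleZygmund01) {z : ℂ}
    (hz : z ∈ unitDisc) :
    ∃ w ∈ unitDisc, ∃ c : ℂ, ‖c‖ = 1 ∧ ∀ f, weighted (S f) z = c * weighted f w := by
  -- The image point is one where the pulled-back peak attains its norm, so evaluation there
  -- composed with `S⁻¹` attains its norm at the peak.
  obtain ⟨w, hw, hmax⟩ := exists_norm_weighted_eq (S.symm (peak z hz))
  rw [S.symm.norm_map, norm_peak] at hmax
  let l : littleZygmund01 →ₗ[ℂ] ℂ := weightedEval w hw ∘ₗ S.symm.toLinearEquiv.toLinearMap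
  have hl : ∀ f, l f = weighted (S.symm f) w := fun _ => rfl
  have h := apply_eq_mul_weighted hz l
    (fun f => by rw [hl, ← S.symm.norm_map f]; exact norm_weighted_le _ _) hmax
  have hne : l (peak z hz) ≠ 0 := by
    intro h0
    rw [hl] at h0
    rw [h0, norm_zero] at hmax
    exact zero_ne_one hmax
  refine ⟨w, hw, (l (peak z hz))⁻¹, by rw [norm_inv, hl, hmax, inv_one], fun f => ?_⟩
  have := h (S f)
  rw [hl (S f), S.symm_apply_apply] at this
  rw [this, inv_mul_cancel_left₀ hne]

end LittleZygmund

/-! ### The symbol and the multiplier of an isometry. -/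

namespace LittleZygmund

theorem exists_second_eq_one : ∃ f : littleZygmund01, ∀ z ∈ unitDisc, second f z = 1 :=
  exists_second_eq one_lt_two (differentiableOn_const (1 : ℂ))

theorem exists_second_eq_id : ∃ f : littleZygmund01, ∀ z ∈ unitDisc, second f z = z :=
  exists_second_eq one_lt_two differentiableOn_id

/-- The function `z² / 2`. -/
noncomputable def quad : littleZygmund01 := exists_second_eq_one.choose

/-- The function `z³ / 6`. -/
noncomputable def cubic : littleZygmund01 := exists_second_eq_id.choose

theorem second_quad {z : ℂ} (hz : z ∈ unitDisc) : second quad z = 1 :=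
  exists_second_eq_one.choose_spec z hz

theorem second_cubic {z : ℂ} (hz : z ∈ unitDisc) : second cubic z = z :=
  exists_second_eq_id.choose_spec z hz

theorem norm_quad_le : ‖quad‖ ≤ 1 := norm_le fun z hz => by
  rw [second_quad hz, norm_one]
  linarith [sq_nonneg ‖z‖]

/-- The self-map of the disc underlying a surjective isometry. -/
noncomputable def symbol (S : littleZygmund01 ≃ₗᵢ[ℂ] littleZygmund01) (z : ℂ) : ℂ :=
  second (S cubic) z / second (S quad) z

/-- Testing on `quad`, whose second derivative is 1, eliminates both the weights and the unimodular
constant. -/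
theorem exists_second_isometry (S : littleZygmund01 ≃ₗᵢ[ℂ] littleZygmund01) {z : ℂ}
    (hz : z ∈ unitDisc) :
    ∃ w ∈ unitDisc, (1 - ‖z‖ ^ 2) * ‖second (S quad) z‖ = 1 - ‖w‖ ^ 2 ∧
      ∀ f, second (S f) z = second (S quad) z * second f w := by
  obtain ⟨w, hw, c, hc, h⟩ := exists_weighted_isometry S hz
  refine ⟨w, hw, ?_, fun f => ?_⟩
  · rw [← norm_weighted _ hz, h, norm_mul, hc, one_mul, norm_weighted _ hw, second_quad hw,
      norm_one, mul_one]
  · have hne : ((1 - ‖z‖ ^ 2 : ℝ) : ℂ) ≠ 0 :=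
      Complex.ofReal_ne_zero.2 (one_sub_norm_sq_pos hz).ne'
    have h1 := h f
    have h2 := h quad
    simp only [weighted, second_quad hw, mul_one] at h1 h2
    refine mul_left_cancel₀ hne ?_
    linear_combination h1 - second f w * h2

theorem second_isometry_quad_ne_zero (S : littleZygmund01 ≃ₗᵢ[ℂ] littleZygmund01) {z : ℂ}
    (hz : z ∈ unitDisc) : second (S quad) z ≠ 0 := by
  obtain ⟨w, hw, h, -⟩ := exists_second_isometry S hz
  intro h0
  rw [h0, norm_zero, mul_zero] at h
  linarith [one_sub_norm_sq_pos hw]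

/-- Testing on `cubic`, whose second derivative is the coordinate, recovers the image point as a
quotient. Hence it is unique and, as a quotient of holomorphic functions, depends holomorphically on
`z`. -/
theorem symbol_spec (S : littleZygmund01 ≃ₗᵢ[ℂ] littleZygmund01) {z : ℂ} (hz : z ∈ unitDisc) :
    symbol S z ∈ unitDisc ∧
      (1 - ‖z‖ ^ 2) * ‖second (S quad) z‖ = 1 - ‖symbol S z‖ ^ 2 ∧
      ∀ f, second (S f) z = second (S quad) z * second f (symbol S z) := by
  obtain ⟨w, hw, h1, h2⟩ := exists_second_isometry S hz
  have : symbol S z = w := by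
    rw [symbol, h2 cubic, second_cubic hw,
      mul_div_cancel_left₀ _ (second_isometry_quad_ne_zero S hz)]
  rw [this]
  exact ⟨hw, h1, h2⟩

theorem symbol_mem (S : littleZygmund01 ≃ₗᵢ[ℂ] littleZygmund01) {z : ℂ} (hz : z ∈ unitDisc) :
    symbol S z ∈ unitDisc :=
  (symbol_spec S hz).1

theorem second_isometry (S : littleZygmund01 ≃ₗᵢ[ℂ] littleZygmund01) {z : ℂ} (hz : z ∈ unitDisc)
    (f : littleZygmund01) : second (S f) z = second (S quad) z * second f (symbol S z) :=
  (symbol_spec S hz).2.2 f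

theorem differentiableOn_symbol (S : littleZygmund01 ≃ₗᵢ[ℂ] littleZygmund01) :
    DifferentiableOn ℂ (symbol S) unitDisc :=
  (differentiableOn_second _).div (differentiableOn_second _)
    fun _ hz => second_isometry_quad_ne_zero S hz

theorem symbol_eq_self {S : littleZygmund01 ≃ₗᵢ[ℂ] littleZygmund01} (h : ∀ f, S f = f) {z : ℂ}
    (hz : z ∈ unitDisc) : symbol S z = z := by
  rw [symbol, h, h, second_cubic hz, second_quad hz, div_one]

/-- Symbols act by precomposition, so they compose in the reverse order. -/
theorem symbol_comp {R S S' : littleZygmund01 ≃ₗᵢ[ℂ] littleZygmund01}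
    (h : ∀ f, R f = S (S' f)) {z : ℂ} (hz : z ∈ unitDisc) :
    symbol R z = symbol S' (symbol S z) := by
  rw [symbol, h, h, second_isometry S hz, second_isometry S hz (S' quad),
    mul_div_mul_left _ _ (second_isometry_quad_ne_zero S hz)]
  rfl

theorem areInverseOnDisc_symbol (S : littleZygmund01 ≃ₗᵢ[ℂ] littleZygmund01) :
    AreInverseOnDisc (symbol S) (symbol S.symm) := by
  refine ⟨differentiableOn_symbol S, differentiableOn_symbol S.symm, fun _ => symbol_mem S,
    fun _ => symbol_mem S.symm, fun z hz => ?_, fun z hz => ?_⟩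
  · rw [← symbol_comp (R := .refl ℂ _) (fun f => (S.apply_symm_apply f).symm) hz]
    exact symbol_eq_self (fun _ => rfl) hz
  · rw [← symbol_comp (R := .refl ℂ _) (fun f => (S.symm_apply_apply f).symm) hz]
    exact symbol_eq_self (fun _ => rfl) hz

/-- Both `(S quad)''` and the derivative of the symbol have modulus `(1 - |σ z|²)/(1 - |z|²)`. Their
quotient is holomorphic and unimodular, hence constant. -/
theorem exists_multiplier (S : littleZygmund01 ≃ₗᵢ[ℂ] littleZygmund01) :
    ∃ c : ℂ, ∀ z ∈ unitDisc, second (S quad) z = c * deriv (symbol S) z := by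
  have hinv := areInverseOnDisc_symbol S
  have hnorm : ∀ z ∈ unitDisc, ‖second (S quad) z / deriv (symbol S) z‖ = 1 := fun z hz => by
    have h1 := (symbol_spec S hz).2.1
    rw [← hinv.weight_mul_norm_deriv hz] at h1
    rw [norm_div, mul_left_cancel₀ (one_sub_norm_sq_pos hz).ne' h1]
    exact div_self (norm_ne_zero_iff.2 (hinv.deriv_ne_zero hz))
  have hd : DifferentiableOn ℂ (fun z => second (S quad) z / deriv (symbol S) z) unitDisc :=
    (differentiableOn_second _).div (hinv.differentiableOn.deriv isOpen_ball)
      fun _ hz => hinv.deriv_ne_zero hz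
  have h0 := ZygmundSpace.zero_mem_unitDisc
  have hc := Complex.eqOn_of_isPreconnected_of_isMaxOn_norm isPreconnected_unitDisc isOpen_ball hd
    h0 (isMaxOn_iff.2 fun z hz => by
      simp only [Function.comp_apply, hnorm z hz, hnorm 0 h0, le_refl])
  refine ⟨second (S quad) 0 / deriv (symbol S) 0, fun z hz => ?_⟩
  exact (div_eq_iff (hinv.deriv_ne_zero hz)).1 (hc hz)

end LittleZygmund

/-! ### Segment integrals as primitives. -/

theorem segmentIntegral_eq_sub {G g : ℂ → ℂ} (hG : ∀ z ∈ unitDisc, HasDerivAt G (g z) z)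
    (hg : ContinuousOn g unitDisc) {z : ℂ} (hz : z ∈ unitDisc) :
    segmentIntegral g z = G z - G 0 := by
  have hmem : ∀ r ∈ Set.uIcc (0 : ℝ) 1, (r : ℂ) * z ∈ unitDisc := fun r hr => by
    rw [Set.uIcc_of_le zero_le_one] at hr
    rw [mem_unitDisc_iff] at hz ⊢
    rw [norm_mul, Complex.norm_real, Real.norm_of_nonneg hr.1]
    nlinarith [norm_nonneg z, hr.1, hr.2]
  have hderiv : ∀ r ∈ Set.uIcc (0 : ℝ) 1,
      HasDerivAt (fun r : ℝ => G (r * z)) (g (r * z) * z) r := fun r hr => by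
    have h1 : HasDerivAt (fun r : ℝ => (r : ℂ) * z) z r := by
      simpa using (Complex.ofRealCLM.hasDerivAt (x := r)).mul_const z
    exact (hG _ (hmem r hr)).comp r h1
  have hcont : ContinuousOn (fun r : ℝ => g (r * z) * z) (Set.uIcc 0 1) :=
    (hg.comp (by fun_prop) hmem).mul continuousOn_const
  rw [segmentIntegral, intervalIntegral.integral_eq_sub_of_hasDerivAt hderiv
    hcont.intervalIntegrable]
  simp

theorem hasDerivAt_segmentIntegral {g : ℂ → ℂ} (hg : DifferentiableOn ℂ g unitDisc) {z : ℂ}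
    (hz : z ∈ unitDisc) : HasDerivAt (segmentIntegral g) (g z) z := by
  obtain ⟨G, -, hG⟩ := hg.isExactOn_ball.with_val_at 0 0
  have hev : segmentIntegral g =ᶠ[𝓝 z] fun w => G w - G 0 := by
    filter_upwards [unitDisc_mem_nhds hz] with w hw
    exact segmentIntegral_eq_sub hG hg.continuousOn hw
  exact ((hG z hz).sub_const _).congr_of_eventuallyEq hev

/-! ### Groups of automorphisms near `t = 0`. -/

namespace IsContinuousAutomorphismGroup

variable {σ : ℝ → ℂ → ℂ}

theorem mem (hσ : IsContinuousAutomorphismGroup σ) (t : ℝ) {z : ℂ} (hz : z ∈ unitDisc) :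
    σ t z ∈ unitDisc :=
  (hσ.automorphism t).2.mapsTo hz

theorem neg_apply (hσ : IsContinuousAutomorphismGroup σ) (t : ℝ) {z : ℂ} (hz : z ∈ unitDisc) :
    σ (-t) (σ t z) = z := by
  rw [← hσ.map_add _ _ z hz, neg_add_cancel, hσ.map_zero z hz]

theorem apply_neg (hσ : IsContinuousAutomorphismGroup σ) (t : ℝ) {z : ℂ} (hz : z ∈ unitDisc) :
    σ t (σ (-t) z) = z := by
  rw [← hσ.map_add _ _ z hz, add_neg_cancel, hσ.map_zero z hz]

theorem areInverseOnDisc (hσ : IsContinuousAutomorphismGroup σ) (t : ℝ) :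
    AreInverseOnDisc (σ t) (σ (-t)) :=
  ⟨(hσ.automorphism t).1, (hσ.automorphism (-t)).1, fun _ => hσ.mem t, fun _ => hσ.mem (-t),
    fun _ => hσ.neg_apply t, fun _ => hσ.apply_neg t⟩

theorem tendsto_center (hσ : IsContinuousAutomorphismGroup σ) :
    Tendsto (fun t => σ (-t) 0) (𝓝 0) (𝓝 0) := by
  have h := ((hσ.continuous 0 ZygmundSpace.zero_mem_unitDisc).comp continuous_neg).tendsto 0
  rwa [Function.comp_apply, neg_zero, hσ.map_zero 0 ZygmundSpace.zero_mem_unitDisc] at h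

/-- The rotation factor is recovered by evaluating at `1/2`, where the Möbius factor tends to `1/2 ≠
0`; pointwise continuity of the group then suffices. -/
theorem exists_rotation (hσ : IsContinuousAutomorphismGroup σ) :
    ∃ μ : ℝ → ℂ, (∀ t, ‖μ t‖ = 1) ∧ (∀ t, ∀ z ∈ unitDisc, σ t z = μ t * mobius (σ (-t) 0) z) ∧
      Tendsto μ (𝓝 0) (𝓝 1) := by
  choose μ hμ h using fun t => (hσ.areInverseOnDisc t).eq_mobius
  refine ⟨μ, hμ, h, ?_⟩
  have hhalf : (1 / 2 : ℂ) ∈ unitDisc := by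
    rw [mem_unitDisc_iff]; norm_num
  have h1 : Tendsto (fun t => σ t (1 / 2)) (𝓝 0) (𝓝 (1 / 2)) := by
    have := (hσ.continuous _ hhalf).tendsto 0
    rwa [hσ.map_zero _ hhalf] at this
  have h2 : Tendsto (fun t => mobius (σ (-t) 0) (1 / 2)) (𝓝 0) (𝓝 (1 / 2)) := by
    have hc : ContinuousAt (fun a => mobius a (1 / 2)) 0 := by
      refine ContinuousAt.div (by fun_prop) ?_ (by simp)
      exact continuousAt_const.sub ((Complex.continuous_conj.continuousAt).mul continuousAt_const)
    have := hc.tendsto.comp hσ.tendsto_center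
    simpa [mobius, Function.comp_def] using this
  have h3 := h1.div h2 (by norm_num)
  rw [div_self (by norm_num)] at h3
  refine h3.congr' ?_
  filter_upwards [h2.eventually_ne (by norm_num : (1 / 2 : ℂ) ≠ 0)] with t ht
  simp only [Pi.div_apply]
  rw [h t _ hhalf, mul_div_cancel_right₀ _ ht]

end IsContinuousAutomorphismGroup

/-- Integrating the functional equation over an interval writes `u` as a difference of primitives,
so `u` is differentiable and satisfies `u' = c u`. -/
theorem exists_eq_exp_of_map_add {u : ℝ → ℂ} (h0 : Tendsto u (𝓝 0) (𝓝 1)) (hu0 : u 0 = 1)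
    (hadd : ∀ s t, u (s + t) = u s * u t) : ∃ c : ℂ, ∀ t, u t = Complex.exp (c * t) := by
  have hcont : Continuous u := by
    rw [continuous_iff_continuousAt]
    intro t
    have h1 : Tendsto (fun x => x - t) (𝓝 t) (𝓝 0) := by
      simpa using (continuous_sub_right t).tendsto t
    have h2 := ((h0.comp h1).const_mul (u t))
    rw [mul_one] at h2
    refine h2.congr fun x => ?_
    rw [Function.comp_apply, ← hadd, add_sub_cancel]
  set G : ℝ → ℂ := fun x => ∫ s in (0 : ℝ)..x, u s with hG
  have hGd : ∀ x, HasDerivAt G (u x) x := fun x =>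
    intervalIntegral.integral_hasDerivAt_right (hcont.intervalIntegrable _ _)
      (hcont.stronglyMeasurableAtFilter _ _) hcont.continuousAt
  -- The primitive has derivative `u 0 = 1` at 0, so it cannot vanish throughout a punctured
  -- neighbourhood.
  obtain ⟨δ, hδ⟩ : ∃ δ, G δ ≠ 0 :=
    ((hGd 0).eventually_ne (by rw [hu0]; exact one_ne_zero)).exists
  have hshift : ∀ t, u t * G δ = G (t + δ) - G t := fun t => by
    rw [hG]
    simp only
    rw [intervalIntegral.integral_interval_sub_left (hcont.intervalIntegrable _ _)
      (hcont.intervalIntegrable _ _), ← intervalIntegral.integral_const_mul]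
    simp_rw [← hadd]
    rw [intervalIntegral.integral_comp_add_left (fun s => u s), add_zero]
  have hud : ∀ t, HasDerivAt u ((u δ - 1) / G δ * u t) t := fun t => by
    have h1 : HasDerivAt (fun t => (G (t + δ) - G t) / G δ) ((u (t + δ) - u t) / G δ) t :=
      (((hGd (t + δ)).comp_add_const t δ).sub (hGd t)).div_const _
    have h2 : u = fun t => (G (t + δ) - G t) / G δ :=
      funext fun t => by rw [← hshift, mul_div_cancel_right₀ _ hδ]
    rw [← h2] at h1
    refine h1.congr_deriv ?_
    rw [hadd]
    ring
  set c := (u δ - 1) / G δ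
  have hconst : ∀ t, HasDerivAt (fun t : ℝ => u t * Complex.exp (-c * t)) 0 t := fun t => by
    have h1 : HasDerivAt (fun t : ℝ => -c * (t : ℂ)) (-c) t := by
      simpa using (Complex.ofRealCLM.hasDerivAt (x := t)).const_mul (-c)
    refine ((hud t).mul h1.cexp).congr_deriv ?_
    ring
  refine ⟨c, fun t => ?_⟩
  have h := is_const_of_deriv_eq_zero (fun t => (hconst t).differentiableAt)
    (fun t => (hconst t).deriv) t 0
  simp only [hu0, Complex.ofReal_zero, mul_zero, Complex.exp_zero, mul_one] at h
  have h2 : u t * Complex.exp (-c * t) * Complex.exp (c * t) = Complex.exp (c * t) := by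
    rw [h, one_mul]
  rwa [mul_assoc, ← Complex.exp_add, neg_mul, neg_add_cancel, Complex.exp_zero, mul_one] at h2

/-! ### From a strongly continuous group to the integral formula. -/

namespace LittleZygmund

variable {T : ℝ → littleZygmund01 ≃ₗᵢ[ℂ] littleZygmund01}

theorem ext_deriv {f g : littleZygmund01}
    (h : ∀ z ∈ unitDisc, deriv (f : ZygmundSpace) z = deriv (g : ZygmundSpace) z) : f = g :=
  ext_second fun z hz => by
    refine (hasDerivAt_deriv f hz).unique ((hasDerivAt_deriv g hz).congr_of_eventuallyEq ?_)
    filter_upwards [unitDisc_mem_nhds hz] with w hw using h w hw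

theorem symbol_add (hT : IsStronglyContinuousGroup T) (s t : ℝ) {z : ℂ} (hz : z ∈ unitDisc) :
    symbol (T (s + t)) z = symbol (T s) (symbol (T t) z) := by
  -- Commutativity of `ℝ` undoes the order reversal of symbols.
  rw [add_comm]
  exact symbol_comp (hT.map_add t s) hz

theorem symbol_zero (hT : IsStronglyContinuousGroup T) {z : ℂ} (hz : z ∈ unitDisc) :
    symbol (T 0) z = z :=
  symbol_eq_self hT.map_zero hz

theorem tendsto_symbol (hT : IsStronglyContinuousGroup T) {z : ℂ} (hz : z ∈ unitDisc) :
    Tendsto (fun t => symbol (T t) z) (𝓝 0) (𝓝 z) := by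
  have h1 := tendsto_second (hT.continuous cubic) hz
  have h2 := tendsto_second (hT.continuous quad) hz
  rw [second_cubic hz] at h1
  rw [second_quad hz] at h2
  have h3 := h1.div h2 one_ne_zero
  rwa [div_one] at h3

theorem isContinuousAutomorphismGroup_symbol (hT : IsStronglyContinuousGroup T) :
    IsContinuousAutomorphismGroup fun t => symbol (T t) where
  automorphism t := (areInverseOnDisc_symbol (T t)).isDiscAutomorphism
  map_zero _ hz := symbol_zero hT hz
  map_add s t _ hz := symbol_add hT s t hz
  continuous z hz := by
    rw [continuous_iff_continuousAt]
    intro t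
    have h1 : Tendsto (fun x => x - t) (𝓝 t) (𝓝 0) := by
      simpa using (continuous_sub_right t).tendsto t
    refine ((tendsto_symbol hT (symbol_mem (T t) hz)).comp h1).congr fun x => ?_
    rw [Function.comp_apply, ← symbol_add hT _ _ hz, sub_add_cancel]

/-- The chain rule at 0 makes the multiplier constants multiplicative in `t`. They tend to 1 because
`(T_t quad)''(0)` and `σ_t'(0)` both do. -/
theorem exists_exponent (hT : IsStronglyContinuousGroup T) :
    ∃ c : ℂ, ∀ t, ∀ z ∈ unitDisc,
      second (T t quad) z = Complex.exp (c * t) * deriv (symbol (T t)) z := by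
  have hσ := isContinuousAutomorphismGroup_symbol hT
  have h0 := ZygmundSpace.zero_mem_unitDisc
  choose u hu using fun t => exists_multiplier (T t)
  have hne : ∀ t, deriv (symbol (T t)) 0 ≠ 0 := fun t =>
    (areInverseOnDisc_symbol (T t)).deriv_ne_zero h0
  have hdiff : ∀ t, ∀ z ∈ unitDisc, DifferentiableAt ℂ (symbol (T t)) z := fun t z hz =>
    (differentiableOn_symbol (T t)).differentiableAt (unitDisc_mem_nhds hz)
  have hadd : ∀ s t, u (s + t) = u s * u t := fun s t => by
    have hchain : deriv (symbol (T (s + t))) 0 =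
        deriv (symbol (T t)) (symbol (T s) 0) * deriv (symbol (T s)) 0 := by
      have hev : symbol (T (s + t)) =ᶠ[𝓝 0] symbol (T t) ∘ symbol (T s) := by
        filter_upwards [unitDisc_mem_nhds h0] with w hw
        rw [add_comm]
        exact symbol_add hT t s hw
      rw [hev.deriv_eq, deriv_comp _ (hdiff t _ (symbol_mem _ h0)) (hdiff s 0 h0)]
    have h1 := hu (s + t) 0 h0
    rw [hT.map_add, second_isometry _ h0, hu s 0 h0, hu t _ (symbol_mem _ h0)] at h1
    refine mul_right_cancel₀ (hne (s + t)) ?_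
    rw [← h1, hchain]
    ring
  have hlim : Tendsto u (𝓝 0) (𝓝 1) := by
    obtain ⟨μ, -, hμ, hμ1⟩ := hσ.exists_rotation
    have hd : ∀ t, deriv (symbol (T t)) 0 =
        μ t * (1 - conj (symbol (T (-t)) 0) * symbol (T (-t)) 0) := fun t => by
      rw [deriv_mul_mobius (hσ.mem (-t) h0) (hμ t) h0]
      simp
    have h1 : Tendsto (fun t => deriv (symbol (T t)) 0) (𝓝 0) (𝓝 1) := by
      have ha := hσ.tendsto_center
      have hb := (Complex.continuous_conj.tendsto 0).comp ha
      have := hμ1.mul ((hb.mul ha).const_sub 1)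
      rw [mul_zero, sub_zero, mul_one] at this
      exact this.congr fun t => (hd t).symm
    have h2 := tendsto_second (hT.continuous quad) h0
    rw [second_quad h0] at h2
    have h3 := h2.div h1 one_ne_zero
    rw [div_one] at h3
    refine h3.congr fun t => ?_
    simp only [Pi.div_apply]
    rw [hu t 0 h0, mul_div_cancel_right₀ _ (hne t)]
  have hu0 : u 0 = 1 := by
    have h1 := hadd 0 0
    have h2 : u 0 ≠ 0 := by
      intro hz
      have := hu 0 0 h0
      rw [hT.map_zero, second_quad h0, hz, zero_mul] at this
      exact one_ne_zero this
    rw [add_zero] at h1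
    exact (mul_left_cancel₀ h2 (by rw [mul_one]; exact h1)).symm
  obtain ⟨c, hc⟩ := exists_eq_exp_of_map_add hlim hu0 hadd
  exact ⟨c, fun t z hz => by rw [hu t z hz, hc]⟩

theorem exists_representation (hT : IsStronglyContinuousGroup T) :
    ∃ (σ : ℝ → ℂ → ℂ) (α : ℂ), IsContinuousAutomorphismGroup σ ∧ IsRepresentedBy T σ α := by
  have hσ := isContinuousAutomorphismGroup_symbol hT
  have h0 := ZygmundSpace.zero_mem_unitDisc
  obtain ⟨c, hc⟩ := exists_exponent hT
  -- Chosen so that `iα = c`; that `α` is real is proved separately.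
  refine ⟨_, -Complex.I * c, hσ, fun t f z hz => ?_⟩
  have hexp : Complex.exp (Complex.I * (-Complex.I * c) * t) = Complex.exp (c * t) := by
    congr 2
    linear_combination (-c) * Complex.I_mul_I
  rw [hexp]
  set e := Complex.exp (c * t) with he
  have hene : e ≠ 0 := Complex.exp_ne_zero _
  set g : ℂ → ℂ := fun ξ => deriv (f : ZygmundSpace) (symbol (T t) ξ) -
    deriv (f : ZygmundSpace) (symbol (T t) 0) with hg
  have hgd : ∀ w ∈ unitDisc,
      HasDerivAt g (second f (symbol (T t) w) * deriv (symbol (T t)) w) w := fun w hw =>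
    ((hasDerivAt_deriv f (symbol_mem _ hw)).comp w
      ((differentiableOn_symbol (T t)).differentiableAt (unitDisc_mem_nhds hw)).hasDerivAt).sub_const
        _
  have hgdiff : DifferentiableOn ℂ g unitDisc := fun w hw =>
    (hgd w hw).differentiableAt.differentiableWithinAt
  have hderiv : ∀ w ∈ unitDisc, deriv (T t f : ZygmundSpace) w = e * g w := by
    -- The two candidates for `(T_t f)'` have equal derivatives and both vanish at 0; this is why
    -- `f'(σ_t(0))` is subtracted.
    have hsub : ∀ w ∈ unitDisc, HasDerivAt
        (fun w => deriv (T t f : ZygmundSpace) w - e * g w) 0 w := fun w hw => by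
      refine ((hasDerivAt_deriv (T t f) hw).sub ((hgd w hw).const_mul e)).congr_deriv ?_
      rw [second_isometry _ hw, hc t w hw]
      ring
    intro w hw
    have := isOpen_ball.is_const_of_deriv_eq_zero isPreconnected_unitDisc
      (fun w hw => (hsub w hw).differentiableAt.differentiableWithinAt)
      (fun w hw => (hsub w hw).deriv) hw h0
    simp only [hg, deriv_zero, sub_self, mul_zero] at this
    rw [← sub_eq_zero]
    exact this
  have hint := segmentIntegral_eq_sub (G := fun w => e⁻¹ * (T t f : ZygmundSpace) w) (g := g)
    (fun w hw => by
      refine ((hasDerivAt (T t f) hw).const_mul e⁻¹).congr_deriv ?_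
      rw [hderiv w hw, inv_mul_cancel_left₀ hene])
    hgdiff.continuousOn hz
  rw [hint, apply_zero, mul_zero, sub_zero, mul_inv_cancel_left₀ hene]

end LittleZygmund

/-! ### Uniform convergence of the automorphisms to the identity. -/

theorem norm_div_one_sub_conj_mul_le {a z w : ℂ} (ha : a ∈ unitDisc) (hz : z ∈ unitDisc)
    (hw : ‖w‖ ≤ 2 * ‖a‖) : ‖w / (1 - conj a * z)‖ ≤ 2 * ‖a‖ / (1 - ‖a‖) := by
  have ha1 := mem_unitDisc_iff.1 ha
  have hz1 := mem_unitDisc_iff.1 hz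
  have h1 : 1 - ‖a‖ ≤ ‖1 - conj a * z‖ := by
    have h2 := norm_sub_norm_le (1 : ℂ) (conj a * z)
    rw [norm_one, norm_mul, RCLike.norm_conj] at h2
    nlinarith [norm_nonneg a]
  have h3 : 0 < 1 - ‖a‖ := by linarith
  rw [norm_div]
  gcongr

namespace IsContinuousAutomorphismGroup

variable {σ : ℝ → ℂ → ℂ}

theorem tendsto_center_bound (hσ : IsContinuousAutomorphismGroup σ) :
    Tendsto (fun t => 2 * ‖σ (-t) 0‖ / (1 - ‖σ (-t) 0‖)) (𝓝 0) (𝓝 0) := by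
  have h := hσ.tendsto_center.norm
  rw [norm_zero] at h
  have h2 := (h.const_mul 2).div (h.const_sub 1) (by norm_num)
  rw [mul_zero, zero_div] at h2
  exact h2

/-- The displacement splits into a rotation error and a Möbius error; both bounds depend only on
`t`. -/
theorem tendstoUniformlyOn (hσ : IsContinuousAutomorphismGroup σ) :
    TendstoUniformlyOn σ id (𝓝 0) unitDisc := by
  obtain ⟨μ, -, hμ, hμ1⟩ := hσ.exists_rotation
  rw [Metric.tendstoUniformlyOn_iff]
  intro ε hε
  have h1 := (hμ1.sub_const 1).norm.add hσ.tendsto_center_bound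
  rw [sub_self, norm_zero, add_zero] at h1
  filter_upwards [h1.eventually (gt_mem_nhds hε)] with t ht z hz
  set a := σ (-t) 0 with ha_def
  have ha : a ∈ unitDisc := hσ.mem (-t) ZygmundSpace.zero_mem_unitDisc
  have hne := one_sub_conj_mul_ne_zero_of_mem ha hz
  have hz1 := mem_unitDisc_iff.1 hz
  have hdiff : mobius a z - z = (conj a * z * z - a) / (1 - conj a * z) := by
    rw [mobius, eq_div_iff hne, sub_mul, div_mul_cancel₀ _ hne]
    ring
  have h2 : ‖mobius a z - z‖ ≤ 2 * ‖a‖ / (1 - ‖a‖) := by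
    rw [hdiff]
    refine norm_div_one_sub_conj_mul_le ha hz ((norm_sub_le _ _).trans ?_)
    rw [norm_mul, norm_mul, RCLike.norm_conj]
    have : ‖a‖ * ‖z‖ * ‖z‖ ≤ ‖a‖ * 1 * 1 := by gcongr
    linarith
  have h3 : ‖(μ t - 1) * mobius a z‖ ≤ ‖μ t - 1‖ := by
    rw [norm_mul]
    exact mul_le_of_le_one_right (norm_nonneg _) (mem_unitDisc_iff.1 (mobius_mem ha hz)).le
  rw [id, dist_comm, dist_eq_norm, hμ t z hz]
  have h4 : μ t * mobius a z - z = (μ t - 1) * mobius a z + (mobius a z - z) := by ring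
  rw [h4]
  exact ((norm_add_le _ _).trans (add_le_add h3 h2)).trans_lt ht

end IsContinuousAutomorphismGroup

/-! ### From the integral formula to a strongly continuous group. -/

namespace LittleZygmund

variable {T : ℝ → littleZygmund01 ≃ₗᵢ[ℂ] littleZygmund01} {σ : ℝ → ℂ → ℂ} {α : ℂ}

theorem deriv_of_isRepresentedBy (hσ : IsContinuousAutomorphismGroup σ)
    (hT : IsRepresentedBy T σ α) (t : ℝ) (f : littleZygmund01) {z : ℂ} (hz : z ∈ unitDisc) :
    deriv (T t f : ZygmundSpace) z = Complex.exp (Complex.I * α * t) *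
      (deriv (f : ZygmundSpace) (σ t z) - deriv (f : ZygmundSpace) (σ t 0)) := by
  have hg : DifferentiableOn ℂ (fun ξ => deriv (f : ZygmundSpace) (σ t ξ) -
      deriv (f : ZygmundSpace) (σ t 0)) unitDisc :=
    ((f : ZygmundSpace).differentiableOn_deriv.comp (hσ.automorphism t).1
      fun _ => hσ.mem t).sub_const _
  have hev : (T t f : ZygmundSpace).1 =ᶠ[𝓝 z] fun w => Complex.exp (Complex.I * α * t) *
      segmentIntegral (fun ξ => deriv (f : ZygmundSpace) (σ t ξ) -
        deriv (f : ZygmundSpace) (σ t 0)) w := by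
    filter_upwards [unitDisc_mem_nhds hz] with w hw using hT t f w hw
  rw [hev.deriv_eq]
  exact ((hasDerivAt_segmentIntegral hg hz).const_mul _).deriv

theorem second_of_isRepresentedBy (hσ : IsContinuousAutomorphismGroup σ)
    (hT : IsRepresentedBy T σ α) (t : ℝ) (f : littleZygmund01) {z : ℂ} (hz : z ∈ unitDisc) :
    second (T t f) z = Complex.exp (Complex.I * α * t) *
      (second f (σ t z) * deriv (σ t) z) := by
  have h1 : HasDerivAt (σ t) (deriv (σ t) z) z :=
    ((hσ.automorphism t).1.differentiableAt (unitDisc_mem_nhds hz)).hasDerivAt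
  have h2 := ((((hasDerivAt_deriv f (hσ.mem t hz)).comp z h1).sub_const
    (deriv (f : ZygmundSpace) (σ t 0))).const_mul (Complex.exp (Complex.I * α * t)))
  refine (hasDerivAt_deriv (T t f) hz).unique (h2.congr_of_eventuallyEq ?_)
  filter_upwards [unitDisc_mem_nhds hz] with w hw using deriv_of_isRepresentedBy hσ hT t f hw

/-- At `σ_{-t}(0)`, which `σ_t` sends to 0, the weighted modulus of `(T_t quad)''` is `|e^{iαt}|`.
The isometry bounds it by 1, and `t = ±1` give both signs. -/
theorem im_eq_zero_of_isRepresentedBy (hσ : IsContinuousAutomorphismGroup σ)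
    (hT : IsRepresentedBy T σ α) : α.im = 0 := by
  have h0 := ZygmundSpace.zero_mem_unitDisc
  have key : ∀ t : ℝ, -(α.im * t) ≤ 0 := fun t => by
    have hz := hσ.mem (-t) h0
    have h1 := (le_norm (T t quad) hz).trans ((T t).norm_map quad ▸ norm_quad_le)
    have h2 := (hσ.areInverseOnDisc t).weight_mul_norm_deriv hz
    rw [second_of_isRepresentedBy hσ hT t quad hz, second_quad (hσ.mem t hz), one_mul, norm_mul,
      mul_left_comm, h2, hσ.apply_neg t h0, norm_zero, Complex.norm_exp] at h1
    have h3 : (Complex.I * α * t).re = -(α.im * t) := by simp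
    rw [h3] at h1
    have h4 : Real.exp (-(α.im * t)) ≤ 1 := by simpa using h1
    exact Real.exp_le_one_iff.1 h4
  linarith [key 1, key (-1)]

/-- `weighted (T_t f)` is `weighted f ∘ σ_t` times a unimodular factor. The factor tends to 1
uniformly, and uniform continuity of `weighted f` handles the composition. -/
theorem tendsto_of_isRepresentedBy (hσ : IsContinuousAutomorphismGroup σ)
    (hT : IsRepresentedBy T σ α) (f : littleZygmund01) :
    Tendsto (fun t => T t f) (𝓝 0) (𝓝 f) := by
  have h0 := ZygmundSpace.zero_mem_unitDisc
  have him := im_eq_zero_of_isRepresentedBy hσ hT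
  obtain ⟨μ, hμn, hμ, hμ1⟩ := hσ.exists_rotation
  have henorm : ∀ t : ℝ, ‖Complex.exp (Complex.I * α * t)‖ = 1 := fun t => by
    rw [Complex.norm_exp]
    simp [him]
  have hlim : Tendsto (fun t : ℝ => (‖Complex.exp (Complex.I * α * t) * μ t - 1‖ +
      2 * ‖σ (-t) 0‖ / (1 - ‖σ (-t) 0‖)) * ‖f‖) (𝓝 0) (𝓝 0) := by
    have he : Tendsto (fun t : ℝ => Complex.exp (Complex.I * α * t)) (𝓝 0) (𝓝 1) := by
      have : Continuous fun t : ℝ => Complex.exp (Complex.I * α * t) := by fun_prop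
      simpa using this.tendsto 0
    have := ((((he.mul hμ1).sub_const 1).norm.add hσ.tendsto_center_bound).mul_const ‖f‖)
    simpa using this
  rw [tendsto_iff_norm_sub_tendsto_zero, Metric.tendsto_nhds]
  intro ε hε
  obtain ⟨δ, hδ, hF⟩ := Metric.uniformContinuous_iff.1 (uniformContinuous_weighted f) (ε / 4)
    (by positivity)
  filter_upwards [Metric.tendstoUniformlyOn_iff.1 hσ.tendstoUniformlyOn δ hδ,
    hlim.eventually (gt_mem_nhds (by positivity : 0 < ε / 4))] with t ht1 ht2
  rw [dist_zero_right, norm_norm]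
  refine lt_of_le_of_lt (norm_le (C := ε / 4 + ε / 4) fun z hz => ?_) (by linarith)
  set a := σ (-t) 0 with ha_def
  set e := Complex.exp (Complex.I * α * t) with he_def
  have ha : a ∈ unitDisc := hσ.mem (-t) h0
  have hne := one_sub_conj_mul_ne_zero_of_mem ha hz
  set d := 1 - conj a * z with hd
  have hnorm_conj : ‖conj d‖ = ‖d‖ := RCLike.norm_conj d
  -- The weight identity absorbs the modulus of `σ_t'`, leaving its phase `μ t · conj d / d`.
  have hw : weighted (T t f) z = e * μ t * (conj d / d) * weighted f (σ t z) := by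
    have h1 : 1 - ‖σ t z‖ ^ 2 = (1 - ‖a‖ ^ 2) * (1 - ‖z‖ ^ 2) / ‖d‖ ^ 2 := by
      rw [hμ t z hz, norm_mul, hμn, one_mul, one_sub_norm_mobius_sq hne]
    have h2 : ((‖d‖ ^ 2 : ℝ) : ℂ) = d * conj d := by
      rw [Complex.mul_conj, Complex.normSq_eq_norm_sq]
    have hdc : conj d ≠ 0 := (map_ne_zero _).2 hne
    rw [weighted, weighted, second_of_isRepresentedBy hσ hT t f hz, h1,
      deriv_mul_mobius ha (hμ t) hz, one_sub_conj_mul_self, Complex.ofReal_div, Complex.ofReal_mul,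
      h2, ← hd, ← he_def]
    field_simp
  have hρ : ‖conj d / d - 1‖ ≤ 2 * ‖a‖ / (1 - ‖a‖) := by
    rw [div_sub_one hne]
    refine norm_div_one_sub_conj_mul_le ha hz ?_
    have h1 : conj d - d = conj a * z - a * conj z := by
      rw [hd]
      simp only [map_sub, map_one, map_mul, Complex.conj_conj]
      ring
    rw [h1]
    refine (norm_sub_le _ _).trans ?_
    rw [norm_mul, norm_mul, RCLike.norm_conj, RCLike.norm_conj]
    have := mem_unitDisc_iff.1 hz
    nlinarith [norm_nonneg a]
  have hρn : ‖conj d / d‖ = 1 := by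
    rw [norm_div, hnorm_conj, div_self (norm_ne_zero_iff.2 hne)]
  have heμ : ‖e * μ t‖ = 1 := by rw [norm_mul, henorm, hμn, one_mul]
  have h1 : ‖weighted f (σ t z) - weighted f z‖ ≤ ε / 4 := by
    have := ht1 z hz
    rw [dist_comm] at this
    rw [← dist_eq_norm]
    exact (hF this).le
  have h2 : ‖e * μ t * (conj d / d) - 1‖ ≤ ‖e * μ t - 1‖ + 2 * ‖a‖ / (1 - ‖a‖) := by
    have : e * μ t * (conj d / d) - 1 = (e * μ t - 1) + e * μ t * (conj d / d - 1) := by ring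
    rw [this]
    refine (norm_add_le _ _).trans ?_
    rw [norm_mul (e * μ t), heμ, one_mul]
    gcongr
  rw [← norm_weighted _ hz]
  have h3 : weighted (T t f - f) z = e * μ t * (conj d / d) * (weighted f (σ t z) - weighted f z) +
      (e * μ t * (conj d / d) - 1) * weighted f z := by
    have : weighted (T t f - f) z = weighted (T t f) z - weighted f z := by
      simp only [weighted, second_sub _ _ hz, mul_sub]
    rw [this, hw]
    ring
  rw [h3]
  refine (norm_add_le _ _).trans (add_le_add ?_ ?_)
  · rw [norm_mul, norm_mul, heμ, hρn, one_mul, one_mul]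
    exact h1
  · rw [norm_mul]
    exact (mul_le_mul h2 (norm_weighted_le f z) (norm_nonneg _)
      ((norm_nonneg _).trans h2)).trans ht2.le

theorem isStronglyContinuousGroup_of_isRepresentedBy (hσ : IsContinuousAutomorphismGroup σ)
    (hT : IsRepresentedBy T σ α) : IsStronglyContinuousGroup T where
  map_zero f := ext_deriv fun z hz => by
    have h0 := ZygmundSpace.zero_mem_unitDisc
    rw [deriv_of_isRepresentedBy hσ hT 0 f hz, hσ.map_zero z hz, hσ.map_zero 0 h0, deriv_zero]
    simp
  -- At the level of first derivatives the constants `f'(σ_t(0))` cancel; the symbols compose in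
  -- reverse order, which is harmless since `ℝ` is commutative.
  map_add s t f := ext_deriv fun z hz => by
    have h0 := ZygmundSpace.zero_mem_unitDisc
    have hz' := hσ.mem s hz
    have h0' := hσ.mem s h0
    rw [deriv_of_isRepresentedBy hσ hT (s + t) f hz, deriv_of_isRepresentedBy hσ hT s _ hz,
      deriv_of_isRepresentedBy hσ hT t f hz', deriv_of_isRepresentedBy hσ hT t f h0', add_comm s t,
      hσ.map_add t s z hz, hσ.map_add t s 0 h0]
    have : Complex.exp (Complex.I * α * ((t + s : ℝ) : ℂ)) =
        Complex.exp (Complex.I * α * s) * Complex.exp (Complex.I * α * t) := by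
      rw [← Complex.exp_add]
      congr 1
      push_cast
      ring
    rw [this]
    ring
  continuous := tendsto_of_isRepresentedBy hσ hT


end LittleZygmund

theorem proposition4p1 (T : ℝ → littleZygmund01 ≃ₗᵢ[ℂ] littleZygmund01) :
    (IsStronglyContinuousGroup T ↔
      ∃ (σ : ℝ → ℂ → ℂ) (α : ℂ), IsContinuousAutomorphismGroup σ ∧ IsRepresentedBy T σ α) ∧
    (∀ (σ : ℝ → ℂ → ℂ) (α : ℂ), IsContinuousAutomorphismGroup σ → IsRepresentedBy T σ α →
      α.im = 0 ∧ TendstoUniformlyOn σ id (nhds 0) unitDisc) := by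
  refine ⟨⟨LittleZygmund.exists_representation, ?_⟩, fun σ α hσ hT =>
    ⟨LittleZygmund.im_eq_zero_of_isRepresentedBy hσ hT, hσ.tendstoUniformlyOn⟩⟩
  rintro ⟨σ, α, hσ, hT⟩
  exact LittleZygmund.isStronglyContinuousGroup_of_isRepresentedBy hσ hT
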